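/- Let $k$ be a field of characteristic zero, let $X$ be an integral projective surface over $k$, and let $C\subset X$ be a reduced irreducible curve. Let $d\ge 1$ be such that there is a very ample effective Cartier divisor $C'$ on $X$ whose Weil divisor is $dC$. Let $P\in C$ be a closed $k$-rational point that is regular on $C$ and on $X$, let $f\in\mathcal O_{X,P}$ be a local equation of $C$ at $P$, and let $\pi:\widehat{\mathcal O}_{X,P}\to k[[u,t]]$ be a local $k$-algebra homomorphism such that $\pi(f)\,k[[u,t]]=t^r\,k[[u,t]]$ and such that $\pi$ induces an isomorphism $\widehat{\mathcal O}_{X,P}/(f)\cong k[[u,t]]/(t)=k[[u]]$. Thus $k[[u,t]]$ is an $\mathcal O_{X,P}$-module through $\pi$, and $\pi(f)$ is invertible in $k[[u]]((t))$. Let $\mathcal F$ be a torsion-free quasi-coherent sheaf on $X$ with an injective $\mathcal O_{X,P}$-linear map $\phi:\mathcal F_P\hookrightarrow k[[u,t]]$. For $n\ge 0$ let $\mathcal F(nC')$ be the subsheaf of $j_*j^*\mathcal F$, where $j:X\setminus C\to X$ is the inclusion, consisting of the sections with poles of order at most $n$ along $C'$, that is, the sections $s$ with $\mathcal O_X(-nC')\,s\subseteq\mathcal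 F$. Every $s\in H^0(X\setminus C,\mathcal F)$ can be written near $P$ as $f^{-N}y$ with $N\ge 0$ and $y$ a section of $\mathcal F$ near $P$, and $\chi_1(s)=\pi(f)^{-N}\phi(y_P)$ defines an injective $k$-linear map $\chi_1:H^0(X\setminus C,\mathcal F)\to k[[u]]((t))$. Put $$W=\chi_1\bigl(H^0(X\setminus C,\mathcal F)\bigr),\qquad W_m=W\cap t^{-mr}k[[u]][[t]]\quad(m\ge 0).$$ Assume that 1. for every $n\ge 0$ and every $w\in W_{nd}$ one has $w\in\pi(f)^{-nd}\phi(\mathcal F_P)$; 2. for every $m>0$ the pull-back $\mathcal F|_{mC'}$ of $\mathcal F$ to the closed subscheme $(C,\mathcal O_X/\mathcal O_X(-mC'))$ of $X$ is pure of dimension one (every nonzero local section has one-dimensional support). Then for all $n\ge 0$ the map $\chi_1$ restricts to an isomorphism of $k$-vector spaces $H^0(X,\mathcal F(nC'))\cong W_{nd}$. -/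

import Mathlib

open CategoryTheory AlgebraicGeometry TopologicalSpace
open scoped PowerSeries

universe u

noncomputable section

namespace RestrictedSchur

/-! ### Sheaves of modules on a scheme -/

section Sheaves

variable {X : Scheme.{u}}

/-- An `𝒪_X`-module `F` on an integral scheme is torsion free if no nonzero section of `𝒪_X`
kills a nonzero section of `F`. -/
def IsTorsionFreeSheaf (F : X.Modules) : Prop :=
  ∀ (U : X.Opens) (a : Γ(X, U)) (s : Γ(F, U)), a • s = 0 → a = 0 ∨ s = 0

/-- `E` is pure of dimension one: every nonzero section of `E` over every open set (equivalently,
for quasi-coherent `E` on an algebraic scheme of dimension one, every nonzero coherent subsheaf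
of `E`) has support of dimension one. -/
def IsPureOfDimOne (E : X.Modules) : Prop :=
  ∀ (U : X.Opens) (s : Γ(E, U)), s ≠ 0 →
    topologicalKrullDim {x : X | ∃ hx : x ∈ U, E.presheaf.germ U x hx s ≠ 0} = 1

/-- The stalk at `x` of an ideal sheaf, as an ideal of `𝒪_{X,x}`. -/
def stalkIdeal (I : X.IdealSheafData) (x : X) : Ideal (X.presheaf.stalk x) :=
  ⨆ (U : X.affineOpens) (hx : x ∈ U.1), (I.ideal U).map (X.presheaf.germ U.1 x hx).hom

/-- The ideal sheaf `I` is that of an effective Cartier divisor: locally it is generated by a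
nonzerodivisor. -/
def IsEffectiveCartier (I : X.IdealSheafData) : Prop :=
  ∀ x : X, ∃ U : X.affineOpens, x ∈ U.1 ∧ ∃ g : Γ(X, U.1),
    g ∈ nonZeroDivisors Γ(X, U.1) ∧ I.ideal U = Ideal.span {g}

open Classical in
/-- The Weil divisor of the effective Cartier divisor with ideal sheaf `I` equals `d • C`, where
`C` is a prime divisor: at every point `x` of codimension one, the multiplicity
`length (𝒪_{X,x} / I_x)` is `d` if `x` is the generic point of `C`, and `0` otherwise. -/
def CycleEq (I : X.IdealSheafData) (d : ℕ) (C : Closeds X) : Prop :=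
  ∀ x : X, ringKrullDim (X.presheaf.stalk x) = 1 →
    Module.length (X.presheaf.stalk x) (X.presheaf.stalk x ⧸ stalkIdeal I x) =
      if closure {x} = (C : Set X) then (d : ℕ∞) else 0

/-- The open complement of a closed set. -/
abbrev complOpen (C : Closeds X) : X.Opens := C.compl

/-- `j_* j^* F`, where `j : X \ C → X` is the inclusion. Its sections over `U` are the sections
of `F` over `U \ C`; its global sections are `H⁰(X \ C, F)`. -/
abbrev awayFrom (C : Closeds X) (F : X.Modules) : X.Modules :=
  (Scheme.Modules.pushforward (complOpen C).ι).obj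
    ((Scheme.Modules.restrictFunctor (complOpen C).ι).obj F)

/-- The restriction `F → j_* j^* F`. -/
abbrev toAwayFrom (C : Closeds X) (F : X.Modules) : F ⟶ awayFrom C F :=
  (Scheme.Modules.restrictAdjunction (complOpen C).ι).unit.app F

/-- `s`, a section of `F` over `U \ C`, satisfies `J s ⊆ F`, locally on `U`. -/
def HasPolesIn (F : X.Modules) (C : Closeds X) (J : X.IdealSheafData) (U : X.Opens)
    (s : Γ(awayFrom C F, U)) : Prop :=
  ∀ x ∈ U, ∃ V : X.affineOpens, x ∈ V.1 ∧ ∃ hV : V.1 ≤ U, ∀ a ∈ J.ideal V,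
    ∃ y : Γ(F, V.1), (toAwayFrom C F).app V.1 y =
      a • (awayFrom C F).presheaf.map (homOfLE hV).op s

lemma exists_affine_le (U : X.Opens) (x : X) (hx : x ∈ U) :
    ∃ V : X.affineOpens, x ∈ V.1 ∧ V.1 ≤ U := by
  obtain ⟨_, ⟨V, hV, rfl⟩, hxV, hVU⟩ :=
    X.isBasis_affineOpens.exists_subset_of_mem_open hx U.2
  exact ⟨⟨V, hV⟩, hxV, hVU⟩

lemma toAwayFrom_map (C : Closeds X) (F : X.Modules) {U V : X.Opens} (h : V ≤ U) (y : Γ(F, U)) :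
    (toAwayFrom C F).app V (F.presheaf.map (homOfLE h).op y) =
      (awayFrom C F).presheaf.map (homOfLE h).op ((toAwayFrom C F).app U y) :=
  ConcreteCategory.congr_hom ((toAwayFrom C F).mapPresheaf.naturality (homOfLE h).op) y

lemma map_map (F : X.Modules) {U V W : X.Opens} (h : V ≤ U) (h' : W ≤ V) (s : Γ(F, U)) :
    F.presheaf.map (homOfLE h').op (F.presheaf.map (homOfLE h).op s) =
      F.presheaf.map (homOfLE (h'.trans h)).op s := by
  rw [← ConcreteCategory.comp_apply, ← Functor.map_comp]
  rfl

lemma hasPolesIn_shrink (F : X.Modules) (C : Closeds X) (J : X.IdealSheafData)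
    {V W : X.affineOpens} (hWV : W.1 ≤ V.1) (s : Γ(awayFrom C F, V.1))
    (h : ∀ a ∈ J.ideal V, ∃ y : Γ(F, V.1), (toAwayFrom C F).app V.1 y = a • s) :
    ∀ a ∈ J.ideal W, ∃ y : Γ(F, W.1), (toAwayFrom C F).app W.1 y =
      a • (awayFrom C F).presheaf.map (homOfLE hWV).op s := by
  intro a ha
  rw [← J.map_ideal hWV] at ha
  refine Submodule.span_induction (p := fun a _ => ∃ y : Γ(F, W.1),
    (toAwayFrom C F).app W.1 y = a • (awayFrom C F).presheaf.map (homOfLE hWV).op s)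
    ?_ ?_ ?_ ?_ ha
  · rintro _ ⟨b, hb, rfl⟩
    obtain ⟨y, hy⟩ := h b hb
    refine ⟨F.presheaf.map (homOfLE hWV).op y, ?_⟩
    rw [toAwayFrom_map, hy, Scheme.Modules.map_smul]
    rfl
  · exact ⟨0, (map_zero _).trans (zero_smul _ _).symm⟩
  · rintro a b _ _ ⟨y, hy⟩ ⟨z, hz⟩
    exact ⟨y + z, by rw [map_add, hy, hz, add_smul]⟩
  · rintro a b _ ⟨y, hy⟩
    exact ⟨a • y, by rw [Scheme.Modules.Hom.app_smul, hy, smul_eq_mul, mul_smul]⟩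

lemma hasPolesIn_add (F : X.Modules) (C : Closeds X) (J : X.IdealSheafData) (U : X.Opens)
    (s t : Γ(awayFrom C F, U)) (hs : HasPolesIn F C J U s) (ht : HasPolesIn F C J U t) :
    HasPolesIn F C J U (s + t) := by
  intro x hx
  obtain ⟨V, hxV, hVU, hV⟩ := hs x hx
  obtain ⟨V', hxV', hVU', hV'⟩ := ht x hx
  obtain ⟨W, hxW, hW⟩ := exists_affine_le (V.1 ⊓ V'.1) x ⟨hxV, hxV'⟩
  refine ⟨W, hxW, hW.trans (inf_le_left.trans hVU), fun a ha => ?_⟩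
  obtain ⟨y, hy⟩ := hasPolesIn_shrink F C J (hW.trans inf_le_left) _ hV a ha
  obtain ⟨z, hz⟩ := hasPolesIn_shrink F C J (hW.trans inf_le_right) _ hV' a ha
  rw [map_map] at hy hz
  refine ⟨y + z, ?_⟩
  rw [map_add, hy, hz, ← smul_add]
  exact congrArg (a • ·) (map_add _ _ _).symm

/-- The subsheaf `{s | J s ⊆ F}` of `j_* j^* F`, as a family of submodules. -/
def polesSubmodule (F : X.Modules) (C : Closeds X) (J : X.IdealSheafData) :
    PresheafOfModules.Submodule (awayFrom C F).val where
  obj U :=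
    { carrier := {s | HasPolesIn F C J U.unop s}
      zero_mem' := by
        intro x hx
        obtain ⟨V, hxV, hVU⟩ := exists_affine_le _ x hx
        refine ⟨V, hxV, hVU, fun a _ => ⟨0, ?_⟩⟩
        exact ((toAwayFrom C F).app V.1).hom.map_zero.trans
          ((congrArg (a • ·) (map_zero _)).trans (smul_zero a)).symm
      add_mem' := fun hs ht => hasPolesIn_add F C J _ _ _ hs ht
      smul_mem' := by
        intro (b : Γ(X, U.unop)) (s : Γ(awayFrom C F, U.unop)) hs x hx
        obtain ⟨V, hxV, hVU, hV⟩ := hs x hx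
        refine ⟨V, hxV, hVU, fun a ha => ?_⟩
        obtain ⟨y, hy⟩ := hV a ha
        refine ⟨X.presheaf.map (homOfLE hVU).op b • y, ?_⟩
        rw [Scheme.Modules.Hom.app_smul, hy, smul_smul, mul_comm, mul_smul]
        exact congrArg (a • ·) (Scheme.Modules.map_smul _ _ _ _).symm }
  map {U U'} f := by
    intro (s : Γ(awayFrom C F, U.unop)) hs x hx
    obtain ⟨V, hxV, hVU, hV⟩ := hs x (f.unop.le hx)
    obtain ⟨W, hxW, hW⟩ := exists_affine_le (V.1 ⊓ U'.unop) x ⟨hxV, hx⟩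
    refine ⟨W, hxW, hW.trans inf_le_right, fun a ha => ?_⟩
    obtain ⟨y, hy⟩ := hasPolesIn_shrink F C J (hW.trans inf_le_left) _ hV a ha
    rw [map_map] at hy
    refine ⟨y, hy.trans (congrArg (a • ·) ?_)⟩
    exact (map_map (awayFrom C F) f.unop.le (hW.trans inf_le_right) s).symm

lemma isSheaf_polesSubmodule (F : X.Modules) (C : Closeds X) (J : X.IdealSheafData) :
    TopCat.Presheaf.IsSheaf (polesSubmodule F C J).toPresheafOfModules.presheaf := by
  rw [TopCat.Presheaf.isSheaf_iff_isSheafUniqueGluing]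
  intro ι U sf hsf
  let G : X.Modules := awayFrom C F
  let G' : TopCat.Sheaf Ab X := ⟨G.presheaf, G.isSheaf⟩
  let tf : ∀ i, Γ(G, U i) := fun i => (sf i).1
  obtain ⟨s, hs, huniq⟩ := G'.existsUnique_gluing U tf (fun i j => congrArg Subtype.val (hsf i j))
  refine ⟨⟨s, ?_⟩, fun i => Subtype.ext (hs i), fun t ht => Subtype.ext ?_⟩
  · intro x hx
    obtain ⟨i, hi⟩ := Opens.mem_iSup.mp hx
    obtain ⟨V, hxV, hVU, hV⟩ := (sf i).2 x hi
    refine ⟨V, hxV, hVU.trans (le_iSup U i), fun a ha => ?_⟩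
    obtain ⟨y, hy⟩ := hV a ha
    refine ⟨y, hy.trans (congrArg (a • ·) ?_)⟩
    have h := hs i
    exact (congrArg (G.presheaf.map (homOfLE hVU).op) h.symm).trans
      (map_map G (le_iSup U i) hVU s)
  · exact huniq t.1 fun i => congrArg Subtype.val (ht i)

/-- The twist `F(nC')` of a torsion free sheaf `F` by the multiple `nC'` of an effective Cartier
divisor `C'` with ideal sheaf `I = 𝒪_X(-C')` and support `C`: the subsheaf of `j_* j^* F` of the
sections with poles of order at most `n` along `C'`, that is, of those `s` with
`𝒪_X(-nC') s ⊆ F`. Where `C'` has the local equation `g`, it is `g⁻ⁿ F`. -/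
def twist (F : X.Modules) (C : Closeds X) (I : X.IdealSheafData) (n : ℕ) : X.Modules where
  val := (polesSubmodule F C (I ^ n)).toPresheafOfModules
  isSheaf := isSheaf_polesSubmodule F C (I ^ n)

/-- The inclusion `F(nC') → j_* j^* F`. -/
def twistι (F : X.Modules) (C : Closeds X) (I : X.IdealSheafData) (n : ℕ) :
    twist F C I n ⟶ awayFrom C F where
  val := (polesSubmodule F C (I ^ n)).ι

end Sheaves

/-! ### Projective space and very ample divisors -/

section VeryAmple

variable (k : Type u) [Field k]

attribute [local instance] MvPolynomial.gradedAlgebra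

/-- Projective `N`-space over `k`. -/
abbrev ProjSpace (N : ℕ) : Scheme.{u} :=
  Proj (MvPolynomial.homogeneousSubmodule (Fin (N + 1)) k)

/-- The structure morphism of projective space. -/
def ProjSpace.str (N : ℕ) : ProjSpace k N ⟶ Spec (.of k) :=
  Proj.toSpecZero (MvPolynomial.homogeneousSubmodule (Fin (N + 1)) k) ≫
    Spec.map (CommRingCat.ofHom
      (algebraMap k (MvPolynomial.homogeneousSubmodule (Fin (N + 1)) k 0)))

/-- The standard open set `x_j ≠ 0`. -/
abbrev ProjSpace.chart (N : ℕ) (j : Fin (N + 1)) : (ProjSpace k N).Opens :=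
  Proj.basicOpen (MvPolynomial.homogeneousSubmodule (Fin (N + 1)) k) (MvPolynomial.X j)

/-- The function `x_0 / x_j` on the standard open set `x_j ≠ 0`; it is the local equation there
of the hyperplane `x_0 = 0`. -/
def ProjSpace.hyperplaneEq (N : ℕ) (j : Fin (N + 1)) :
    Γ(ProjSpace k N, ProjSpace.chart k N j) :=
  (Proj.awayToSection (MvPolynomial.homogeneousSubmodule (Fin (N + 1)) k)
      (MvPolynomial.X j)).hom
    (HomogeneousLocalization.Away.mk _ (d := 1) (MvPolynomial.isHomogeneous_X k j) 1
      (MvPolynomial.X 0) (MvPolynomial.isHomogeneous_X k 0))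

variable {k}

/-- The effective Cartier divisor on the `k`-scheme `X` with ideal sheaf `I` is very ample (and
`X` is projective): for some closed embedding of `X` into a projective space over `k`, it is the
scheme-theoretic intersection of `X` with the hyperplane `x_0 = 0`. -/
def IsVeryAmple {X : Scheme.{u}} (str : X ⟶ Spec (.of k)) (I : X.IdealSheafData) : Prop :=
  ∃ (N : ℕ) (i : X ⟶ ProjSpace k N), IsClosedImmersion i ∧ i ≫ ProjSpace.str k N = str ∧
    ∀ (j : Fin (N + 1)) (U : X.affineOpens) (hU : U.1 ≤ i ⁻¹ᵁ ProjSpace.chart k N j),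
      I.ideal U = Ideal.span {X.presheaf.map (homOfLE hU).op
        (i.app (ProjSpace.chart k N j) (ProjSpace.hyperplaneEq k N j))}

/-- The action of the ground field on functions on an open set of a `k`-scheme. -/
def scalar {X : Scheme.{u}} (str : X ⟶ Spec (.of k)) (U : X.Opens) : k →+* Γ(X, U) :=
  ((Scheme.ΓSpecIso (.of k)).inv ≫ str.appTop ≫ X.presheaf.map (homOfLE le_top).op).hom

end VeryAmple

/-! ### The surface, the curve, the point and the formal parameters

The ring `k[[u,t]]` is `k⟦X⟧⟦X⟧`: power series in `t` over power series in `u`. The ring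
`k[[u]]((t))` is `LaurentSeries k⟦X⟧`. -/

section Setting

/-- The completion of the local ring at a point. -/
abbrev CompletedStalk {X : Scheme.{u}} (P : X) : Type u :=
  AdicCompletion (IsLocalRing.maximalIdeal (X.presheaf.stalk P)) (X.presheaf.stalk P)

/-- The data `(X, C, C', P, π)`: a projective surface `X`, a curve `C` on it with a very ample
multiple `C' = dC`, a point `P` and a homomorphism `π` from the completed local ring at `P`
to `k[[u,t]]`. -/
structure SurfaceData (k : Type u) [Field k] where
  /-- the surface, which is projective by `veryAmple` -/
  X : Scheme.{u}
  /-- its structure morphism -/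
  str : X ⟶ Spec (.of k)
  isIntegral : IsIntegral X
  dim_eq : topologicalKrullDim X = 2
  /-- the reduced irreducible curve `C` -/
  C : Closeds X
  irreducible_C : IsIrreducible (C : Set X)
  dim_C : topologicalKrullDim C = 1
  /-- the multiple of `C` that is a very ample Cartier divisor `C'` -/
  d : ℕ
  d_pos : 0 < d
  /-- the ideal sheaf `𝒪_X(-C')` -/
  I : X.IdealSheafData
  cartier : IsEffectiveCartier I
  cycle_eq : CycleEq I d C
  veryAmple : IsVeryAmple str I
  /-- the point, which is a closed `k`-point, lies on `C` and is regular on `C` and on `X` -/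
  P : X
  P_mem : P ∈ C
  P_closed : IsClosed {P}
  P_rational : Function.Bijective
    ((X.residue P).hom.comp ((X.presheaf.germ ⊤ P trivial).hom.comp (scalar str ⊤)))
  P_regular : IsRegularLocalRing (X.presheaf.stalk P)
  P_regular_C : IsRegularLocalRing
    (X.presheaf.stalk P ⧸ stalkIdeal (Scheme.IdealSheafData.vanishingIdeal C) P)
  /-- a local equation of `C` at `P` -/
  f : X.presheaf.stalk P
  span_f : Ideal.span {f} = stalkIdeal (Scheme.IdealSheafData.vanishingIdeal C) P
  /-- the rank -/
  r : ℕ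
  /-- the local `k`-algebra homomorphism `π` -/
  π : CompletedStalk P →+* k⟦X⟧⟦X⟧
  π_local : IsLocalHom π
  π_scalar : ∀ c : k, π (algebraMap (X.presheaf.stalk P) (CompletedStalk P)
    (X.presheaf.germ ⊤ P trivial (scalar str ⊤ c))) = PowerSeries.C (PowerSeries.C c)
  /-- `π(f) k[[u,t]] = tʳ k[[u,t]]` -/
  π_f : Ideal.span {π (algebraMap (X.presheaf.stalk P) (CompletedStalk P) f)} =
    Ideal.span {(PowerSeries.X : k⟦X⟧⟦X⟧) ^ r}
  /-- `π` induces a surjection onto `k[[u]] = k[[u,t]] / (t)` ... -/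
  π_surjective : Function.Surjective (PowerSeries.constantCoeff.comp π)
  /-- ... and an injection of the completed local ring of `C` at `P` into it -/
  π_ker : RingHom.ker (PowerSeries.constantCoeff.comp π) =
    Ideal.span {algebraMap (X.presheaf.stalk P) (CompletedStalk P) f}

variable {k : Type u} [Field k] (D : SurfaceData k)

/-- The restriction of `π` to the local ring at `P`. -/
def SurfaceData.π₀ : D.X.presheaf.stalk D.P →+* k⟦X⟧⟦X⟧ :=
  D.π.comp (algebraMap (D.X.presheaf.stalk D.P) (CompletedStalk D.P))

/-- The embedding of `k[[u,t]]` into `k[[u]]((t))`. -/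
abbrev toLaurent : k⟦X⟧⟦X⟧ →+* LaurentSeries k⟦X⟧ := HahnSeries.ofPowerSeries ℤ k⟦X⟧

/-- An embedding of `𝒪_P`-modules of the stalk `F_P` into `k[[u,t]]`, which is an
`𝒪_P`-module through `π`. -/
structure StalkEmbedding (F : D.X.Modules) where
  /-- the underlying additive map -/
  toHom : F.presheaf.stalk D.P →+ k⟦X⟧⟦X⟧
  injective : Function.Injective toHom
  map_smul : ∀ (U : D.X.Opens) (hP : D.P ∈ U) (a : Γ(D.X, U)) (y : Γ(F, U)),
    toHom (F.presheaf.germ U D.P hP (a • y)) =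
      D.π₀ (D.X.presheaf.germ U D.P hP a) * toHom (F.presheaf.germ U D.P hP y)

variable {D} {F : D.X.Modules} (φ : StalkEmbedding D F)

/-- The graph of the map `χ₁ : H⁰(X \ C, F) → k[[u]]((t))`. Near `P`, a section `s` over `X \ C`
is `f⁻ᴺ y` for some `N` and some section `y` of `F`; its image is `π(f)⁻ᴺ φ(y)`. -/
def IsExpansion (s : Γ(awayFrom D.C F, ⊤)) (w : LaurentSeries k⟦X⟧) : Prop :=
  ∃ (U : D.X.Opens) (hP : D.P ∈ U) (g : Γ(D.X, U)) (N : ℕ) (y : Γ(F, U)),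
    D.X.presheaf.germ U D.P hP g = D.f ∧
    (toAwayFrom D.C F).app U y =
      g ^ N • (awayFrom D.C F).presheaf.map (homOfLE le_top).op s ∧
    toLaurent (D.π₀ D.f) ^ N * w = toLaurent (φ.toHom (F.presheaf.germ U D.P hP y))

/-- The space `W = χ₁(H⁰(X \ C, F))`. -/
def spaceW : Set (LaurentSeries k⟦X⟧) :=
  {w | ∃ s : Γ(awayFrom D.C F, ⊤), IsExpansion φ s w}

/-- The filtration `W_m = W ∩ t^(-mr) k[[u]][[t]]`. -/
def filtrationW (m : ℕ) : Set (LaurentSeries k⟦X⟧) :=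
  {w | w ∈ spaceW φ ∧ ∃ a : k⟦X⟧⟦X⟧, w = HahnSeries.single (-((m * D.r : ℕ) : ℤ)) 1 * toLaurent a}

variable (F) in
/-- The restriction of `F` to the scheme `(C, 𝒪_X / 𝒪_X(-mC'))`, that is, the pull-back of `F` to
the closed subscheme `mC'`. -/
def restrictToMultiple (m : ℕ) : (D.I ^ m).subscheme.Modules :=
  (Scheme.Modules.pullback (D.I ^ m).subschemeι).obj F

variable (F) in
/-- The sheaf `F(nC')`. -/
abbrev twistBy (n : ℕ) : D.X.Modules := twist F D.C D.I n

end Setting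

end RestrictedSchur

end

open RestrictedSchur

noncomputable section

/-! Both inclusions compare the pole order of a section `s` of `F` over `X \ C` with that of its
expansion `w` at `P`. The bridge is `SurfaceData.stalkIdeal_I`: at `P` the divisor `C'` has the
local equation `f ^ d`. Indeed a local equation `h` of `C'` lies in only one height one prime of the
Noetherian domain `𝒪_P`, namely `(f)`, and has multiplicity `d` there.

If `𝒪(-nC') s ⊆ F`, then `π(f) ^ (n * d) * w` is a power series, and `π(f)` is `t ^ r` times a unit;
this bounds the pole of `w` (`exists_eq_single_mul_of_hasPolesIn`).

Conversely, let `w` lie in `W_{nd}`. Assumption 1 gives `f ^ (n * d) s ∈ F_P`, since `φ` is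
injective and `F` is torsion free, so the pole bound holds near `P` (`exists_poles_le_at_P`). Purity
propagates it (`hasPolesIn_of_purity`). The points where the bound fails form a closed set `Z`,
properly contained in `C` as it misses `P`. Let `g` be a local equation of `C'` at a point of `Z`.
For some `m > 0` the section `y = g ^ (m + n) s` lies in `F`. Its class in `F|_{mC'}` vanishes
exactly where `g ^ m` divides `y`, that is, where the bound holds. So this class is nonzero with
support inside `Z`. A subset of a proper closed subset of `C` cannot have dimension one, which
contradicts purity. -/

namespace RestrictedSchur

/-! ### Sections of quasi-coherent modules over basic open sets. -/

section QuasiCoherent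

variable {X : Scheme.{u}} (F : X.Modules)

lemma isLocalizedModule_res_basicOpen {R : CommRingCat.{u}} (M : (Spec R).Modules)
    [M.IsQuasicoherent] (f : R) (V : (Spec R).Opens) (hV : PrimeSpectrum.basicOpen f = V) :
    IsLocalizedModule (.powers f) ((modulesSpecToSheaf.obj M).obj.map V.leTop.op).hom := by
  subst hV
  exact (isIso_fromTildeΓ_iff_isLocalizing M).mp inferInstance f

lemma spec_exists_pow_smul_eq_res {R : CommRingCat.{u}} (M : (Spec R).Modules) [M.IsQuasicoherent]
    (f : R) (V : (Spec R).Opens) (hV : PrimeSpectrum.basicOpen f = V) (t : Γ(M, V)) :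
    ∃ (n : ℕ) (y : Γ(M, ⊤)), M.presheaf.map V.leTop.op y = f ^ n • t := by
  have := isLocalizedModule_res_basicOpen M f V hV
  obtain ⟨⟨y, ⟨_, n, rfl⟩⟩, hn⟩ := IsLocalizedModule.surj (.powers f)
    ((modulesSpecToSheaf.obj M).obj.map V.leTop.op).hom t
  exact ⟨n, y, hn.symm⟩

lemma spec_exists_pow_smul_eq_zero {R : CommRingCat.{u}} (M : (Spec R).Modules) [M.IsQuasicoherent]
    (f : R) (V : (Spec R).Opens) (hV : PrimeSpectrum.basicOpen f = V) (s : Γ(M, ⊤))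
    (hs : M.presheaf.map V.leTop.op s = 0) :
    ∃ n : ℕ, f ^ n • s = 0 := by
  have := isLocalizedModule_res_basicOpen M f V hV
  obtain ⟨⟨_, n, rfl⟩, hn⟩ := (IsLocalizedModule.eq_zero_iff (.powers f)
    ((modulesSpecToSheaf.obj M).obj.map V.leTop.op).hom).mp hs
  exact ⟨n, hn⟩

/-- Matches the action of `Γ(X, U)` on the module transported to the spectrum with the action on
`X`; statements about spectra then transfer to affine open sets. -/
lemma restrict_fromSpec_smul {U : X.Opens} (hU : IsAffineOpen U) (r : Γ(X, U))
    (W : (Spec Γ(X, U)).Opens) (hVU : hU.fromSpec ''ᵁ W ≤ U)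
    (x : Γ(F.restrict hU.fromSpec, W)) :
    (F.restrictAppIso hU.fromSpec W).hom (r • x) =
      X.presheaf.map (homOfLE hVU).op r • (F.restrictAppIso hU.fromSpec W).hom x := by
  rw [Scheme.Modules.smul_Spec_def]
  have h2 : (hU.fromSpec.appIso W).inv ((Spec Γ(X, U)).presheaf.map W.leTop.op
      ((Scheme.ΓSpecIso Γ(X, U)).inv r)) = X.presheaf.map (homOfLE hVU).op r := by
    rw [← ConcreteCategory.comp_apply, ← ConcreteCategory.comp_apply]
    congr 2
    rw [← Category.assoc, Iso.comp_inv_eq, hU.fromSpec.appIso_hom,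
      hU.fromSpec.naturality_assoc, hU.fromSpec_app_self]
    simp only [Category.assoc, ← Functor.map_comp]
    rfl
  have h1 := Scheme.Modules.smul_restrictAppIso_hom_apply hU.fromSpec F W
    ((Spec Γ(X, U)).presheaf.map W.leTop.op ((Scheme.ΓSpecIso Γ(X, U)).inv r)) x
  simp only [h2] at h1
  exact h1

lemma res_res {U V W : X.Opens} (i : V ⟶ U) (j : W ⟶ V) (k : W ⟶ U) (s : Γ(F, U)) :
    F.presheaf.map j.op (F.presheaf.map i.op s) = F.presheaf.map k.op s := by
  rw [← ConcreteCategory.comp_apply, ← Functor.map_comp]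
  rfl

lemma res_self {U : X.Opens} (i : U ⟶ U) (s : Γ(F, U)) :
    F.presheaf.map i.op s = s := by
  rw [Subsingleton.elim i (𝟙 U), op_id, F.presheaf.map_id]
  rfl

lemma ring_res_res {U V W : X.Opens} (i : V ⟶ U) (j : W ⟶ V) (k : W ⟶ U) (s : Γ(X, U)) :
    X.presheaf.map j.op (X.presheaf.map i.op s) = X.presheaf.map k.op s := by
  rw [← ConcreteCategory.comp_apply, ← Functor.map_comp]
  rfl

lemma ring_res_self {U : X.Opens} (i : U ⟶ U) (s : Γ(X, U)) :
    X.presheaf.map i.op s = s := by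
  rw [Subsingleton.elim i (𝟙 U), op_id, X.presheaf.map_id]
  rfl

lemma exists_pow_smul_eq_res [F.IsQuasicoherent] {U : X.Opens} (hU : IsAffineOpen U) (g : Γ(X, U))
    {V : X.Opens} (hV : X.basicOpen g = V) (hVU : V ≤ U) (t : Γ(F, V)) :
    ∃ (N : ℕ) (y : Γ(F, U)), F.presheaf.map (homOfLE hVU).op y =
      X.presheaf.map (homOfLE hVU).op g ^ N • t := by
  have e1 : hU.fromSpec ''ᵁ ⊤ = U := by simp
  obtain ⟨W, hW⟩ : ∃ W : (Spec Γ(X, U)).Opens, PrimeSpectrum.basicOpen g = W := ⟨_, rfl⟩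
  rw [← hU.fromSpec_image_basicOpen, hW] at hV
  subst hV
  obtain ⟨n, y, hy⟩ := spec_exists_pow_smul_eq_res (F.restrict hU.fromSpec) g W hW t
  refine ⟨n, F.presheaf.map (eqToHom e1.symm).op ((F.restrictAppIso hU.fromSpec _).hom y), ?_⟩
  rw [res_res F _ _ (homOfLE (hU.fromSpec.image_mono le_top)), ← map_pow]
  exact hy.trans (restrict_fromSpec_smul F hU (g ^ n) _ hVU t)

lemma exists_pow_smul_eq_zero [F.IsQuasicoherent] {U : X.Opens} (hU : IsAffineOpen U)
    (g : Γ(X, U)) {V : X.Opens} (hV : X.basicOpen g = V) (hVU : V ≤ U) (s : Γ(F, U))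
    (hs : F.presheaf.map (homOfLE hVU).op s = 0) :
    ∃ N : ℕ, g ^ N • s = 0 := by
  have e1 : hU.fromSpec ''ᵁ ⊤ = U := by simp
  obtain ⟨W, hW⟩ : ∃ W : (Spec Γ(X, U)).Opens, PrimeSpectrum.basicOpen g = W := ⟨_, rfl⟩
  rw [← hU.fromSpec_image_basicOpen, hW] at hV
  subst hV
  obtain ⟨n, hn⟩ := spec_exists_pow_smul_eq_zero (F.restrict hU.fromSpec) g W hW
    (F.presheaf.map (eqToHom e1).op s) (by
      refine Eq.trans ?_ hs
      exact res_res F (eqToHom e1) (homOfLE (hU.fromSpec.image_mono le_top)) (homOfLE hVU) s)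
  refine ⟨n, ?_⟩
  have h2 := (restrict_fromSpec_smul F hU (g ^ n) ⊤ e1.le (F.presheaf.map (eqToHom e1).op s)).symm
  have h3 : X.presheaf.map (homOfLE e1.le).op (g ^ n) • F.presheaf.map (eqToHom e1).op s = 0 :=
    h2.trans hn
  have h4 := congrArg (F.presheaf.map (eqToHom e1.symm).op) h3
  rw [map_zero, Scheme.Modules.map_smul, res_res F _ _ (𝟙 U), res_self, ring_res_res _ _ (𝟙 U),
    ring_res_self] at h4
  exact h4

end QuasiCoherent

/-! ### Injectivity of restriction for torsion-free sheaves. -/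

section TorsionFree

variable {X : Scheme.{u}} {F : X.Modules}

lemma pow_smul_eq_zero_of_torsionFree (hF : IsTorsionFreeSheaf F) {U : X.Opens} (g : Γ(X, U))
    (hg : g ≠ 0) (n : ℕ) (s : Γ(F, U)) (h : g ^ n • s = 0) : s = 0 := by
  induction n with
  | zero => simpa using h
  | succ n ih =>
    rw [pow_succ', mul_smul] at h
    exact ih ((hF U g _ h).resolve_left hg)

lemma modules_subsingleton (F : X.Modules) {U : X.Opens} (hU : (U : Set X) = ∅) (s t : Γ(F, U)) :
    s = t := by
  have : U = ⊥ := by ext; simp [hU]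
  refine TopCat.Sheaf.eq_of_locally_eq' ⟨F.presheaf, F.isSheaf⟩ (ι := PEmpty.{1})
    (fun i => i.elim) U
    (fun i => i.elim) (by rw [this]; exact bot_le) s t (fun i => i.elim)

/-- By irreducibility every affine piece of `U` meets `V`, so it contains some nonempty `D(g)`
inside `V`. A section vanishing on `V` is killed there by a power of `g`, hence is zero by
torsion-freeness. -/
lemma res_injective [IsIntegral X] [F.IsQuasicoherent] (hF : IsTorsionFreeSheaf F) {U V : X.Opens}
    (i : V ⟶ U) (hV : (V : Set X).Nonempty) : Function.Injective (F.presheaf.map i.op) := by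
  rw [injective_iff_map_eq_zero]
  intro s hs
  have key : ∀ x : U, ∃ W : X.affineOpens, x.1 ∈ W.1 ∧ W.1 ≤ U :=
    fun x => exists_affine_le U x.1 x.2
  choose W hxW hWU using key
  refine TopCat.Sheaf.eq_of_locally_eq' ⟨F.presheaf, F.isSheaf⟩ (fun x => (W x).1) U
    (fun x => homOfLE (hWU x)) (fun x hx => Opens.mem_iSup.mpr ⟨⟨x, hx⟩, hxW _⟩) s 0 fun x => ?_
  rw [map_zero]
  change F.presheaf.map (homOfLE (hWU x)).op s = 0
  have hne : ((W x).1 ⊓ V : X.Opens).1.Nonempty := by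
    obtain ⟨z, hz⟩ := nonempty_preirreducible_inter (W x).1.2 V.2 ⟨x.1, hxW x⟩ hV
    exact ⟨z, hz⟩
  obtain ⟨z, hzW, hzV⟩ := hne
  obtain ⟨g, hg, hzg⟩ := (W x).2.exists_basicOpen_le ⟨z, hzV⟩ hzW
  obtain ⟨N, hN⟩ := exists_pow_smul_eq_zero F (W x).2 g rfl (X.basicOpen_le g)
    (F.presheaf.map (homOfLE (hWU x)).op s) (by
      rw [res_res F _ _ (homOfLE (hg.trans i.le)), ← res_res F i (homOfLE hg), hs, map_zero])
  refine pow_smul_eq_zero_of_torsionFree hF g ?_ N _ hN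
  rintro rfl
  simp at hzg

lemma ring_res_injective [IsIntegral X] {U V : X.Opens} (i : V ⟶ U) (hV : (V : Set X).Nonempty) :
    Function.Injective (X.presheaf.map i.op) :=
  haveI : Nonempty V := hV.to_subtype
  map_injective_of_isIntegral X i

end TorsionFree

/-! ### Elements of a Noetherian domain with a single height one prime. -/

section Multiplicity
open IsLocalRing

/-- The localization at `(f)` is a discrete valuation ring with uniformizer `f`. -/
lemma length_quotient_localization_span_pow {R S : Type*} [CommRing R] [IsDomain R]
    [IsNoetherianRing R] [CommRing S] [Algebra R S] {f : R} (hf : f ≠ 0)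
    [hp : (Ideal.span {f}).IsPrime] [IsLocalization.AtPrime S (Ideal.span {f})] (e : ℕ) :
    Module.length S (S ⧸ Ideal.span {algebraMap R S (f ^ e)}) = e := by
  have : IsDomain S := IsLocalization.isDomain_of_le_nonZeroDivisors S
    (Ideal.span {f}).primeCompl_le_nonZeroDivisors
  have : IsNoetherianRing S := IsLocalization.isNoetherianRing (Ideal.span {f}).primeCompl S ‹_›
  have : IsLocalRing S := IsLocalization.AtPrime.isLocalRing S (Ideal.span {f})
  have hm : maximalIdeal S = Ideal.span {algebraMap R S f} := by
    rw [← IsLocalization.AtPrime.map_eq_maximalIdeal (Ideal.span {f}) S, Ideal.map_span,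
      Set.image_singleton]
  have hf' : algebraMap R S f ≠ 0 := fun h0 => hf
    (IsLocalization.injective S (Ideal.span {f}).primeCompl_le_nonZeroDivisors (by simpa using h0))
  have hnf : ¬ IsField S := by
    rw [isField_iff_maximalIdeal_eq, hm, Ideal.span_singleton_eq_bot]
    exact hf'
  have : IsDiscreteValuationRing S :=
    ((IsDiscreteValuationRing.TFAE S hnf).out 0 4 :
      IsDiscreteValuationRing S ↔ (maximalIdeal S).IsPrincipal).mpr ⟨⟨_, hm⟩⟩
  rw [map_pow, ← Ideal.span_singleton_pow, ← hm]
  exact IsDiscreteValuationRing.length_quotient_pow_maximalIdeal S e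

/-- In a Noetherian domain, an element `h` whose only height one prime is the principal prime `(f)`
is associated to a power of `f`, the exponent being the length of the localization at `(f)`. -/
lemma span_eq_span_pow_of_length {R S : Type*} [CommRing R] [IsDomain R] [IsNoetherianRing R]
    [CommRing S] [Algebra R S] {f h : R} (hf : f ≠ 0) (hh : h ≠ 0)
    [hp : (Ideal.span {f}).IsPrime] [IsLocalization.AtPrime S (Ideal.span {f})] {d : ℕ}
    (hd : Module.length S (S ⧸ Ideal.span {algebraMap R S h}) = d)
    (hQ : ∀ Q : Ideal R, Q.IsPrime → Q.height = 1 → h ∈ Q → Q = Ideal.span {f}) :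
    Ideal.span {h} = Ideal.span {f ^ d} := by
  have hfp : Prime f := (Ideal.span_singleton_prime hf).mp hp
  obtain ⟨e, h', hndvd, rfl⟩ := WfDvdMonoid.max_power_factor hh hfp.irreducible
  have hu : IsUnit h' := by
    -- A minimal prime over the cofactor `h'` has height one by Krull's theorem, so it would be
    -- `(f)`, although `f` does not divide `h'`.
    by_contra hu
    obtain ⟨Q, hQm⟩ := Ideal.nonempty_minimalPrimes (I := Ideal.span {h'})
      (by rwa [Ne, Ideal.span_singleton_eq_top])
    have hQp : Q.IsPrime := hQm.1.1
    have hmem : h' ∈ Q := hQm.1.2 (Ideal.mem_span_singleton_self h')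
    have hht : Q.height = 1 := by
      refine le_antisymm
        (Ideal.height_le_one_of_isPrincipal_of_mem_minimalPrimes (Ideal.span {h'}) Q hQm) ?_
      rw [Order.one_le_iff_ne_zero, Ne, Ideal.height_eq_zero_iff_eq_bot]
      rintro rfl
      exact right_ne_zero_of_mul hh hmem
    have := hQ Q hQp hht (Q.mul_mem_left _ hmem)
    exact hndvd (Ideal.mem_span_singleton.mp (this ▸ hmem))
  have hs : Ideal.span {f ^ e * h'} = Ideal.span {f ^ e} :=
    Ideal.span_singleton_mul_right_unit hu _
  have hs' : Ideal.span {algebraMap R S (f ^ e * h')} = Ideal.span {algebraMap R S (f ^ e)} := by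
    rw [map_mul]
    exact Ideal.span_singleton_mul_right_unit (hu.map _) _
  rw [hs', length_quotient_localization_span_pow hf] at hd
  rw [hs, Nat.cast_inj.mp hd]

lemma height_span_singleton_prime {R : Type*} [CommRing R] [IsDomain R] [IsNoetherianRing R] {f : R}
    (hf : f ≠ 0) (hp : (Ideal.span {f}).IsPrime) : (Ideal.span {f}).height = 1 := by
  refine le_antisymm (Ideal.height_le_one_of_isPrincipal_of_mem_minimalPrimes (Ideal.span {f}) _
    (by rw [Ideal.minimalPrimes_eq_subsingleton_self]; rfl)) ?_
  rw [Order.one_le_iff_ne_zero, Ne, Ideal.height_eq_zero_iff_eq_bot, Ideal.span_singleton_eq_bot]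
  exact hf

end Multiplicity

/-! ### Dimension of subsets of a curve. -/

section KrullDim
open TopologicalSpace

/-- A subset of a proper closed subset of an irreducible closed set of dimension one does not have
dimension one. -/
lemma topologicalKrullDim_ne_one_of_subset {X S : Type*} [TopologicalSpace X] [TopologicalSpace S]
    {C Z : Set X} (hC : IsIrreducible C) (hdim : topologicalKrullDim C = 1)
    (hZ : IsClosed Z) (hZC : Z ⊂ C) (i : S → X) (hi : Topology.IsInducing i) (hiZ : ∀ x, i x ∈ Z) :
    topologicalKrullDim S ≠ 1 := by
  intro h1
  let j : S → C := fun x => ⟨i x, hZC.subset (hiZ x)⟩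
  have hj : Topology.IsInducing j := hi.codRestrict fun x => hZC.subset (hiZ x)
  have : IrreducibleSpace C := Subtype.irreducibleSpace hC
  obtain ⟨p, hp⟩ := Order.le_krullDim_iff.mp
    (show ((1 : ℕ) : WithBot ℕ∞) ≤ Order.krullDim (IrreducibleCloseds S) from h1.ge)
  let m := IrreducibleCloseds.map j hj.continuous
  let top : IrreducibleCloseds C := ⟨Set.univ, IrreducibleSpace.isIrreducible_univ C, isClosed_univ⟩
  -- Closures in `C` of the members of a chain in `S` stay inside `Z`, so `C` itself can be added on
  -- top. A chain of length one in `S` would then give one of length two in `C`.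
  have hlt : m p.last < top := by
    obtain ⟨z, hzC, hzZ⟩ := Set.exists_of_ssubset hZC
    refine lt_of_le_of_ne (fun _ _ => trivial) fun h => hzZ ?_
    have hz : (⟨z, hzC⟩ : C) ∈ (m p.last : Set C) := by rw [h]; trivial
    have hsub : (m p.last : Set C) ⊆ Subtype.val ⁻¹' Z := by
      rw [IrreducibleCloseds.coe_map]
      refine closure_minimal ?_ (hZ.preimage continuous_subtype_val)
      rintro _ ⟨x, -, rfl⟩
      exact hiZ x
    exact hsub hz
  have hq := Order.LTSeries.length_le_krullDim ((p.map m
    (IrreducibleCloseds.map_strictMono_of_isInducing hj)).snoc top (by simpa using hlt))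
  have hC2 : Order.krullDim (IrreducibleCloseds C) = 1 := hdim
  rw [hC2] at hq
  simp only [RelSeries.snoc_length, LTSeries.map_length, hp] at hq
  exact absurd hq (by norm_num)

end KrullDim

/-! ### Stalks of ideal sheaves; generizations of a point as primes of its local ring. -/

section Stalks

variable {X : Scheme.{u}}

lemma map_germ_res {U V : X.Opens} (i : V ⟶ U) (x : X) (hx : x ∈ V) (J : Ideal Γ(X, U)) :
    (J.map (X.presheaf.map i.op).hom).map (X.presheaf.germ V x hx).hom =
      J.map (X.presheaf.germ U x (i.le hx)).hom := by
  rw [Ideal.map_map, ← X.presheaf.germ_res i x hx]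
  rfl

lemma stalkIdeal_eq_map (I : X.IdealSheafData) (x : X) (U : X.affineOpens) (hx : x ∈ U.1) :
    stalkIdeal I x = (I.ideal U).map (X.presheaf.germ U.1 x hx).hom := by
  have key : ∀ (V : X.affineOpens) (hV : x ∈ V.1), (I.ideal V).map (X.presheaf.germ V.1 x hV).hom =
      (I.ideal U).map (X.presheaf.germ U.1 x hx).hom := by
    intro V hV
    obtain ⟨W, hxW, hW⟩ := exists_affine_le (V.1 ⊓ U.1) x ⟨hV, hx⟩
    have h1 : W ≤ V := hW.trans inf_le_left
    have h2 : W ≤ U := hW.trans inf_le_right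
    rw [← map_germ_res (homOfLE h1) x hxW, ← map_germ_res (homOfLE h2) x hxW]
    exact congrArg _ ((I.map_ideal h1).trans (I.map_ideal h2).symm)
  refine le_antisymm (iSup₂_le fun V hV => (key V hV).le) (le_iSup₂_of_le U hx le_rfl)

lemma stalkIdeal_pow (I : X.IdealSheafData) (n : ℕ) (x : X) :
    stalkIdeal (I ^ n) x = stalkIdeal I x ^ n := by
  obtain ⟨U, hx, -⟩ := exists_affine_le ⊤ x trivial
  rw [stalkIdeal_eq_map _ x U hx, stalkIdeal_eq_map _ x U hx, ← Ideal.map_pow]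
  rfl

lemma map_stalkSpecializes_stalkIdeal (I : X.IdealSheafData) {x y : X} (h : x ⤳ y) :
    (stalkIdeal I y).map (X.presheaf.stalkSpecializes h).hom = stalkIdeal I x := by
  obtain ⟨U, hy, -⟩ := exists_affine_le ⊤ y trivial
  have hx : x ∈ U.1 := h.mem_open U.1.2 hy
  rw [stalkIdeal_eq_map _ x U hx, stalkIdeal_eq_map _ y U hy, Ideal.map_map,
    ← X.presheaf.germ_stalkSpecializes hy h]
  rfl

/-- The prime ideal of the local ring at `y` given by a generization `x` of `y`. -/
def generizationPrime {x y : X} (h : x ⤳ y) : Ideal (X.presheaf.stalk y) :=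
  (IsLocalRing.maximalIdeal (X.presheaf.stalk x)).comap (X.presheaf.stalkSpecializes h).hom

instance {x y : X} (h : x ⤳ y) : (generizationPrime h).IsPrime :=
  inferInstanceAs (Ideal.comap _ _).IsPrime

lemma fromSpecStalk_generizationPrime {x y : X} (h : x ⤳ y) :
    X.fromSpecStalk y ⟨generizationPrime h, inferInstance⟩ = x := by
  conv_rhs => rw [← Scheme.fromSpecStalk_closedPoint (x := x),
    ← Scheme.SpecMap_stalkSpecializes_fromSpecStalk h]
  rfl

/-- Translates the cycle condition, which concerns points of `X`, into a condition on the primes of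
`𝒪_P`. -/
lemma exists_generizationPrime_eq (y : X) (Q : Ideal (X.presheaf.stalk y)) (hQ : Q.IsPrime) :
    ∃ (x : X) (h : x ⤳ y), generizationPrime h = Q := by
  have h : X.fromSpecStalk y ⟨Q, hQ⟩ ⤳ y := by
    have : X.fromSpecStalk y ⟨Q, hQ⟩ ∈ Set.range (X.fromSpecStalk y) := ⟨_, rfl⟩
    rwa [Scheme.range_fromSpecStalk] at this
  refine ⟨_, h, ?_⟩
  have := (X.fromSpecStalk y).isEmbedding.injective (fromSpecStalk_generizationPrime h)
  exact congrArg PrimeSpectrum.asIdeal this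

/-- Both stalks are localizations of the coordinate ring of an affine neighbourhood of `y`. Hence
`𝒪_x` is the localization of `𝒪_y` at the image of the complement of the prime of `x`. Every element
outside `generizationPrime h` divides an element of this image, so the submonoid may be enlarged. -/
lemma isLocalization_stalkSpecializes {x y : X} (h : x ⤳ y) :
    @IsLocalization.AtPrime _ _ (X.presheaf.stalk x) _
      (X.presheaf.stalkSpecializes h).hom.toAlgebra (generizationPrime h) _ := by
  obtain ⟨U, hy, -⟩ := exists_affine_le ⊤ y trivial
  have hx : x ∈ U.1 := h.mem_open U.1.2 hy
  let := (X.presheaf.stalkSpecializes h).hom.toAlgebra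
  let := (X.presheaf.germ U.1 x hx).hom.toAlgebra
  let := (X.presheaf.germ U.1 y hy).hom.toAlgebra
  have hlx : IsLocalization.AtPrime (X.presheaf.stalk x) (U.2.primeIdealOf ⟨x, hx⟩).asIdeal :=
    U.2.isLocalization_stalk ⟨x, hx⟩
  have hly : IsLocalization.AtPrime (X.presheaf.stalk y) (U.2.primeIdealOf ⟨y, hy⟩).asIdeal :=
    U.2.isLocalization_stalk ⟨y, hy⟩
  have : IsScalarTower Γ(X, U.1) (X.presheaf.stalk y) (X.presheaf.stalk x) := by
    refine .of_algebraMap_eq' ?_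
    have := X.presheaf.germ_stalkSpecializes hy h
    exact congrArg CommRingCat.Hom.hom this.symm
  have hcx : ∀ a, a ∈ (U.2.primeIdealOf ⟨x, hx⟩).asIdeal ↔
      algebraMap Γ(X, U.1) (X.presheaf.stalk x) a ∈ IsLocalRing.maximalIdeal (X.presheaf.stalk x) :=
    fun a => (IsLocalization.AtPrime.to_map_mem_maximal_iff (X.presheaf.stalk x)
      (U.2.primeIdealOf ⟨x, hx⟩).asIdeal a).symm
  have hle : (U.2.primeIdealOf ⟨y, hy⟩).asIdeal.primeCompl ≤
      (U.2.primeIdealOf ⟨x, hx⟩).asIdeal.primeCompl := by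
    intro a ha ha'
    have hu := IsLocalization.map_units (X.presheaf.stalk y)
      (⟨a, ha⟩ : (U.2.primeIdealOf ⟨y, hy⟩).asIdeal.primeCompl)
    have hu' := hu.map (algebraMap (X.presheaf.stalk y) (X.presheaf.stalk x))
    rw [← IsScalarTower.algebraMap_apply] at hu'
    exact (hcx a).mp ha' hu'
  have h1 := IsLocalization.isLocalization_of_submonoid_le (X.presheaf.stalk y)
    (X.presheaf.stalk x) _ _ hle
  refine IsLocalization.isLocalization_of_is_exists_mul_mem _ _ (h := ?_) (h' := ?_)
    (M := (U.2.primeIdealOf ⟨x, hx⟩).asIdeal.primeCompl.map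
      (algebraMap Γ(X, U.1) (X.presheaf.stalk y)))
  · rintro _ ⟨a, ha, rfl⟩ ha'
    refine ha ((hcx a).mpr ?_)
    rw [IsScalarTower.algebraMap_apply Γ(X, U.1) (X.presheaf.stalk y) (X.presheaf.stalk x)]
    exact ha'
  · rintro ⟨b, hb⟩
    obtain ⟨⟨a, s⟩, e⟩ := IsLocalization.surj (U.2.primeIdealOf ⟨y, hy⟩).asIdeal.primeCompl b
    refine ⟨algebraMap _ _ s.1, a, fun ha => hb ?_, (mul_comm _ _).trans e |>.symm⟩
    have h2 := (hcx a).mp ha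
    rw [IsScalarTower.algebraMap_apply Γ(X, U.1) (X.presheaf.stalk y) (X.presheaf.stalk x), ← e,
      map_mul, ← IsScalarTower.algebraMap_apply] at h2
    have hu := IsLocalization.map_units (X.presheaf.stalk x)
      (⟨s.1, hle s.2⟩ : (U.2.primeIdealOf ⟨x, hx⟩).asIdeal.primeCompl)
    exact (Ideal.unit_mul_mem_iff_mem _ hu).mp (by rwa [mul_comm] at h2)

lemma mem_vanishingIdeal_iff (C : Closeds X) (U : X.affineOpens) (g : Γ(X, U.1)) :
    g ∈ (Scheme.IdealSheafData.vanishingIdeal C).ideal U ↔ ∀ z ∈ C, z ∉ X.basicOpen g := by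
  rw [Scheme.IdealSheafData.vanishingIdeal_ideal, PrimeSpectrum.mem_vanishingIdeal]
  constructor
  · intro h z hz hzg
    have hzU : z ∈ U.1 := X.basicOpen_le g hzg
    have e := U.2.fromSpec_primeIdealOf ⟨z, hzU⟩
    have h1 := h (U.2.primeIdealOf ⟨z, hzU⟩)
      (show U.2.fromSpec (U.2.primeIdealOf ⟨z, hzU⟩) ∈ C by rw [e]; exact hz)
    have h2 : U.2.primeIdealOf ⟨z, hzU⟩ ∈ PrimeSpectrum.basicOpen g := by
      rw [← U.2.fromSpec_preimage_basicOpen g]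
      change U.2.fromSpec (U.2.primeIdealOf ⟨z, hzU⟩) ∈ X.basicOpen g
      rw [e]
      exact hzg
    exact h2 h1
  · intro h q hq
    by_contra hgq
    refine h _ hq ?_
    have h2 : q ∈ PrimeSpectrum.basicOpen g := hgq
    rw [← U.2.fromSpec_preimage_basicOpen g] at h2
    exact h2

end Stalks

/-! ### The generic point of the curve and the local equation of `C'` at `P`. -/

section Surface

variable {k : Type u} [Field k] (D : SurfaceData k)

instance : IsIntegral D.X := D.isIntegral

instance : IsNoetherianRing (D.X.presheaf.stalk D.P) :=
  D.P_regular.toIsNoetherian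

/-- The generic point of `C`. -/
def SurfaceData.η : D.X := D.irreducible_C.genericPoint

lemma SurfaceData.closure_η : closure {D.η} = (D.C : Set D.X) := by
  have := D.irreducible_C.isGenericPoint_genericPoint_closure
  rw [D.C.isClosed.closure_eq] at this
  exact this

lemma SurfaceData.η_mem : D.η ∈ D.C := by
  change D.η ∈ (D.C : Set D.X)
  rw [← D.closure_η]
  exact subset_closure rfl

lemma SurfaceData.η_specializes {x : D.X} (hx : x ∈ D.C) : D.η ⤳ x := by
  rw [specializes_iff_mem_closure, D.closure_η]
  exact hx

lemma SurfaceData.stalkIdeal_vanishing_le :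
    stalkIdeal (Scheme.IdealSheafData.vanishingIdeal D.C) D.η ≤
      IsLocalRing.maximalIdeal (D.X.presheaf.stalk D.η) := by
  obtain ⟨U, hU, -⟩ := exists_affine_le ⊤ D.η trivial
  rw [stalkIdeal_eq_map _ _ U hU, Ideal.map_le_iff_le_comap]
  intro g hg hu
  exact (mem_vanishingIdeal_iff D.C U g).mp hg D.η D.η_mem
    ((D.X.mem_basicOpen g D.η hU).mpr hu)

/-- If a function is a nonunit at `η`, its basic open set misses all of `C`: any open set meeting
`C` contains `η`. So the function lies in the vanishing ideal of `C`. -/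
lemma SurfaceData.generizationPrime_η :
    generizationPrime (D.η_specializes D.P_mem) = Ideal.span {D.f} := by
  rw [D.span_f]
  apply le_antisymm
  · intro a ha
    obtain ⟨V, hPV, g, rfl⟩ := D.X.presheaf.exists_germ_eq a
    obtain ⟨U, hPU, hUV⟩ := exists_affine_le V D.P hPV
    rw [← D.X.presheaf.germ_res_apply (homOfLE hUV) D.P hPU] at ha ⊢
    rw [stalkIdeal_eq_map _ _ U hPU]
    refine Ideal.mem_map_of_mem _ ((mem_vanishingIdeal_iff _ _ _).mpr fun z hz hzg => ?_)
    have hηg := (D.η_specializes hz).mem_open (Opens.isOpen _) hzg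
    have hηU : D.η ∈ U.1 := D.X.basicOpen_le _ hηg
    have hu := (D.X.mem_basicOpen _ D.η hηU).mp hηg
    rw [← D.X.presheaf.germ_stalkSpecializes_apply hPU (D.η_specializes D.P_mem)] at hu
    exact ha hu
  · rw [generizationPrime, ← Ideal.map_le_iff_le_comap, map_stalkSpecializes_stalkIdeal]
    exact D.stalkIdeal_vanishing_le

lemma SurfaceData.exists_unit_π_f : ∃ v : k⟦X⟧⟦X⟧, IsUnit v ∧
    D.π₀ D.f = PowerSeries.X ^ D.r * v := by
  obtain ⟨v, hv⟩ := Ideal.span_singleton_eq_span_singleton.mp D.π_f.symm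
  exact ⟨v, v.isUnit, hv.symm⟩

lemma SurfaceData.π_f_ne_zero : D.π₀ D.f ≠ 0 := by
  obtain ⟨v, hv, h⟩ := D.exists_unit_π_f
  rw [h]
  exact mul_ne_zero (pow_ne_zero _ PowerSeries.X_ne_zero) hv.ne_zero

lemma SurfaceData.f_ne_zero : D.f ≠ 0 := fun h => D.π_f_ne_zero (by rw [h, map_zero])

lemma SurfaceData.isPrime_span_f : (Ideal.span {D.f}).IsPrime :=
  D.generizationPrime_η ▸ inferInstance

/-- Needed to evaluate `cycle_eq` at `η`; the local ring is that of `𝒪_P` at the principal prime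
`(f)`. -/
lemma SurfaceData.ringKrullDim_η : ringKrullDim (D.X.presheaf.stalk D.η) = 1 := by
  let := (D.X.presheaf.stalkSpecializes (D.η_specializes D.P_mem)).hom.toAlgebra
  have := isLocalization_stalkSpecializes (D.η_specializes D.P_mem)
  rw [IsLocalization.AtPrime.ringKrullDim_eq_height
    (generizationPrime (D.η_specializes D.P_mem)) (D.X.presheaf.stalk D.η),
    D.generizationPrime_η, height_span_singleton_prime D.f_ne_zero D.isPrime_span_f]
  rfl

lemma exists_stalkIdeal_eq_span {X : Scheme.{u}} [IsIntegral X] {I : X.IdealSheafData}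
    (hI : IsEffectiveCartier I) (x : X) :
    ∃ h : X.presheaf.stalk x, h ≠ 0 ∧ stalkIdeal I x = Ideal.span {h} := by
  obtain ⟨U, hx, g, hg, e⟩ := hI x
  have : Nonempty U.1 := ⟨⟨x, hx⟩⟩
  refine ⟨X.presheaf.germ U.1 x hx g, fun h0 => ?_, ?_⟩
  · have : g = 0 := germ_injective_of_isIntegral X x hx (by rw [h0, map_zero])
    exact nonZeroDivisors.ne_zero hg this
  · rw [stalkIdeal_eq_map I x U hx, e, Ideal.map_span, Set.image_singleton]

lemma SurfaceData.stalkIdeal_I : stalkIdeal D.I D.P = Ideal.span {D.f ^ D.d} := by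
  obtain ⟨h, hh, e⟩ := exists_stalkIdeal_eq_span D.cartier D.P
  rw [e]
  have hη := D.η_specializes D.P_mem
  have := D.isPrime_span_f
  let := (D.X.presheaf.stalkSpecializes hη).hom.toAlgebra
  have hloc : IsLocalization.AtPrime (D.X.presheaf.stalk D.η) (Ideal.span {D.f}) := by
    have := isLocalization_stalkSpecializes hη
    simp only [D.generizationPrime_η] at this
    exact this
  refine span_eq_span_pow_of_length (S := D.X.presheaf.stalk D.η) D.f_ne_zero hh ?_ ?_
  · have h1 := D.cycle_eq D.η D.ringKrullDim_η
    rw [if_pos D.closure_η, ← map_stalkSpecializes_stalkIdeal D.I hη, e, Ideal.map_span,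
      Set.image_singleton] at h1
    exact h1
  · intro Q hQp hQh hhQ
    obtain ⟨x, hx, rfl⟩ := exists_generizationPrime_eq D.P Q hQp
    let := (D.X.presheaf.stalkSpecializes hx).hom.toAlgebra
    have := isLocalization_stalkSpecializes hx
    have hdim : ringKrullDim (D.X.presheaf.stalk x) = 1 := by
      rw [IsLocalization.AtPrime.ringKrullDim_eq_height (generizationPrime hx)
        (D.X.presheaf.stalk x), hQh]
      rfl
    have h1 := D.cycle_eq x hdim
    have hle : stalkIdeal D.I x ≤ IsLocalRing.maximalIdeal _ := by
      rw [← map_stalkSpecializes_stalkIdeal D.I hx, e, Ideal.map_span, Set.image_singleton,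
        Ideal.span_singleton_le_iff_mem]
      exact hhQ
    -- Were `x` not generic in `C`, the multiplicity of `C'` at `x` would be zero and `I_x` the unit
    -- ideal, although `h` lies in the prime of `x`.
    have hcl : closure {x} = (D.C : Set D.X) := by
      by_contra hcl
      rw [if_neg hcl, Module.length_eq_zero_iff, Submodule.Quotient.subsingleton_iff] at h1
      exact (IsLocalRing.maximalIdeal.isMaximal _).ne_top (top_le_iff.mp (h1.ge.trans hle))
    have hxη : x = D.η := by
      have : closure {x} = closure {D.η} := hcl.trans D.closure_η.symm
      exact (Inseparable.eq (inseparable_iff_closure_eq.mpr this))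
    subst hxη
    exact D.generizationPrime_η

/-- If `D(g)` met `C` it would contain `η`; then `g` would be a unit there and the multiplicity
would be `0` instead of `d > 0`. -/
lemma SurfaceData.basicOpen_le_compl {U : D.X.affineOpens} {g : Γ(D.X, U.1)}
    (hg : D.I.ideal U = Ideal.span {g}) : D.X.basicOpen g ≤ complOpen D.C := by
  intro x hx hxC
  have hη := (D.η_specializes hxC).mem_open (Opens.isOpen _) hx
  have hηU : D.η ∈ U.1 := D.X.basicOpen_le _ hη
  have hu := (D.X.mem_basicOpen _ D.η hηU).mp hη
  have h1 := D.cycle_eq D.η D.ringKrullDim_η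
  rw [if_pos D.closure_η, stalkIdeal_eq_map _ _ U hηU, hg, Ideal.map_span, Set.image_singleton,
    Ideal.span_singleton_eq_top.mpr hu] at h1
  have h2 : Module.length (D.X.presheaf.stalk D.η) (D.X.presheaf.stalk D.η ⧸
      (⊤ : Ideal (D.X.presheaf.stalk D.η))) = 0 := by
    rw [Module.length_eq_zero_iff, Submodule.Quotient.subsingleton_iff]
  rw [h2] at h1
  exact D.d_pos.ne (by exact_mod_cast h1)

lemma SurfaceData.basicOpen_le_compl_of_germ_eq {U : D.X.Opens} {g : Γ(D.X, U)} (hP : D.P ∈ U)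
    (hg : D.X.presheaf.germ U D.P hP g = D.f) : D.X.basicOpen g ≤ complOpen D.C := by
  intro x hx hxC
  have hη := (D.η_specializes hxC).mem_open (Opens.isOpen _) hx
  have hηU : D.η ∈ U := D.X.basicOpen_le _ hη
  have hu := (D.X.mem_basicOpen _ D.η hηU).mp hη
  rw [← D.X.presheaf.germ_stalkSpecializes_apply hP (D.η_specializes D.P_mem), hg] at hu
  have : D.f ∈ generizationPrime (D.η_specializes D.P_mem) := by
    rw [D.generizationPrime_η]
    exact Ideal.mem_span_singleton_self _
  exact this hu

/-- The dimensions `1` and `2` show `C ≠ X`, and `X` is irreducible. -/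
lemma SurfaceData.inter_compl_nonempty {U : D.X.Opens} (hU : (U : Set D.X).Nonempty) :
    ((U ⊓ complOpen D.C : D.X.Opens) : Set D.X).Nonempty := by
  have hne : ((complOpen D.C : D.X.Opens) : Set D.X).Nonempty := by
    by_contra h
    have hC : (D.C : Set D.X) = Set.univ := by
      rw [Set.not_nonempty_iff_eq_empty] at h
      exact Set.compl_empty_iff.mp h
    have h1 := D.dim_C
    have h2 : topologicalKrullDim (D.C : Set D.X) = topologicalKrullDim D.X := by
      rw [hC]
      exact (Homeomorph.Set.univ D.X).isHomeomorph.topologicalKrullDim_eq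
    rw [D.dim_eq] at h2
    have h3 : (2 : WithBot ℕ∞) = 1 := h2.symm.trans h1
    exact absurd h3 (by decide)
  exact nonempty_preirreducible_inter U.2 (complOpen D.C).2 hU hne

end Surface

/-! ### Skyscraper modules, used to test whether a section dies in a pull-back. -/

section Skyscraper

variable {Z : Scheme.{u}} (x : Z) (N : Type u) [AddCommGroup N] [Module (Z.presheaf.stalk x) N]

/-- The sections over `V` of the skyscraper sheaf at `x` with value `N`. -/
def SkyscraperSections (_ : Module (Z.presheaf.stalk x) N) (V : Z.Opens) : Type u :=
  PLift (x ∈ V) → N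

variable {x N} in
instance (i : Module (Z.presheaf.stalk x) N) (V : Z.Opens) :
    AddCommGroup (SkyscraperSections x N i V) :=
  inferInstanceAs (AddCommGroup (PLift (x ∈ V) → N))

variable {x N} in
instance (i : Module (Z.presheaf.stalk x) N) (V : Z.Opens) :
    Module Γ(Z, V) (SkyscraperSections x N i V) where
  smul r f := fun h => Z.presheaf.germ V x h.down r • (f h : N)
  one_smul f := funext fun h =>
    (congrArg (fun a : Z.presheaf.stalk x => a • (f h : N)) (map_one _)).trans (one_smul _ _)
  mul_smul r s f := funext fun h =>
    (congrArg (fun a : Z.presheaf.stalk x => a • (f h : N)) (map_mul _ r s)).trans (mul_smul _ _ _)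
  smul_zero r := funext fun h => smul_zero (Z.presheaf.germ V x h.down r)
  smul_add r f g := funext fun h =>
    smul_add (Z.presheaf.germ V x h.down r) (f h : N) (g h : N)
  add_smul r s f := funext fun h =>
    (congrArg (fun a : Z.presheaf.stalk x => a • (f h : N)) (map_add _ r s)).trans (add_smul _ _ _)
  zero_smul f := funext fun h =>
    (congrArg (fun a : Z.presheaf.stalk x => a • (f h : N)) (map_zero _)).trans (zero_smul _ _)

/-- The skyscraper presheaf of abelian groups at `x` with value `N`. -/
def skyscraperAb : TopCat.Presheaf Ab.{u} Z where
  obj V := AddCommGrpCat.of (SkyscraperSections x N ‹_› V.unop)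
  map i := AddCommGrpCat.ofHom
    { toFun := fun f h => f ⟨i.unop.le h.down⟩
      map_zero' := rfl
      map_add' := fun _ _ => rfl }
  map_id _ := rfl
  map_comp _ _ := rfl

lemma isSheaf_skyscraperAb : TopCat.Presheaf.IsSheaf (skyscraperAb x N) := by
  rw [TopCat.Presheaf.isSheaf_iff_isSheafUniqueGluing]
  intro ι U sf hsf
  classical
  have hex : ∀ h : PLift (x ∈ iSup U), ∃ i, x ∈ U i := fun h => Opens.mem_iSup.mp h.down
  refine ⟨fun h => sf (hex h).choose ⟨(hex h).choose_spec⟩, fun i => ?_, fun s hs => ?_⟩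
  · funext h
    exact congrFun (hsf (hex ⟨Opens.mem_iSup.mpr ⟨i, h.down⟩⟩).choose i)
      ⟨⟨(hex ⟨Opens.mem_iSup.mpr ⟨i, h.down⟩⟩).choose_spec, h.down⟩⟩
  · funext h
    exact congrFun (hs (hex h).choose) ⟨(hex h).choose_spec⟩

/-- The skyscraper sheaf of modules at `x` with value the `𝒪_x`-module `N`. -/
def skyscraperModule : Z.Modules where
  val :=
    letI (V : Z.Opensᵒᵖ) : Module (Z.ringCatSheaf.obj.obj V) ((skyscraperAb x N).obj V) :=
      inferInstanceAs (Module Γ(Z, V.unop) (SkyscraperSections x N ‹_› V.unop))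
    PresheafOfModules.ofPresheaf (R := Z.ringCatSheaf.obj) (skyscraperAb x N) (by
      intro U V i r f
      funext h
      exact congrArg (fun a : Z.presheaf.stalk x => a • (f ⟨i.unop.le h.down⟩ : N))
        (Z.presheaf.germ_res_apply i.unop x h.down r).symm)
  isSheaf := isSheaf_skyscraperAb x N

variable {X : Scheme.{u}} (ι : Z ⟶ X) (F : X.Modules)

/-- A semilinear map from the stalk of `F` at `ι x` induces a morphism from `F` to the
push-forward of the skyscraper sheaf. -/
def toSkyscraper (θ : F.presheaf.stalk (ι x) →+ N)
    (hθ : ∀ (U : X.Opens) (hx : ι x ∈ U) (a : Γ(X, U)) (y : Γ(F, U)),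
      θ (F.presheaf.germ U (ι x) hx (a • y)) =
        ι.stalkMap x (X.presheaf.germ U (ι x) hx a) • θ (F.presheaf.germ U (ι x) hx y)) :
    F ⟶ (Scheme.Modules.pushforward ι).obj (skyscraperModule x N) where
  val := PresheafOfModules.homMk
    { app := fun U => AddCommGrpCat.ofHom
        { toFun := fun y h => θ (F.presheaf.germ U.unop (ι x) h.down y)
          map_zero' := funext fun h => (congrArg θ (map_zero _)).trans (map_zero θ)
          map_add' := fun a b => funext fun h =>
            (congrArg θ (map_add _ a b)).trans (map_add θ _ _) }
      naturality := by
        intro U V i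
        ext y
        funext h
        exact congrArg θ (F.presheaf.germ_res_apply i.unop (ι x) h.down y) } (by
    intro U r y
    funext h
    refine (hθ U.unop h.down r y).trans ?_
    exact congrArg (fun a : Z.presheaf.stalk x => a • θ (F.presheaf.germ U.unop (ι x) h.down y))
      (Scheme.Hom.germ_stalkMap_apply ι U.unop x h.down r))

/-- By adjunction the map from `F` to the push-forward of the skyscraper factors through the unit `F
→ ι_* ι^* F`. Thus no description of the stalks of `ι^* F` is needed. -/
lemma germ_eq_zero_of_unit_eq_zero (θ : F.presheaf.stalk (ι x) →+ N)
    (hθ : ∀ (U : X.Opens) (hx : ι x ∈ U) (a : Γ(X, U)) (y : Γ(F, U)),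
      θ (F.presheaf.germ U (ι x) hx (a • y)) =
        ι.stalkMap x (X.presheaf.germ U (ι x) hx a) • θ (F.presheaf.germ U (ι x) hx y))
    (U : X.Opens) (hx : ι x ∈ U) (y : Γ(F, U))
    (hy : ((Scheme.Modules.pullbackPushforwardAdjunction ι).unit.app F).app U y = 0) :
    θ (F.presheaf.germ U (ι x) hx y) = 0 := by
  let α := toSkyscraper x N ι F θ hθ
  let β := ((Scheme.Modules.pullbackPushforwardAdjunction ι).homEquiv _ _).symm α
  have h1 : (Scheme.Modules.pullbackPushforwardAdjunction ι).unit.app F ≫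
      (Scheme.Modules.pushforward ι).map β = α :=
    ((Scheme.Modules.pullbackPushforwardAdjunction ι).homEquiv_unit ..).symm.trans
      (Equiv.apply_symm_apply _ _)
  have h2 : α.app U y = 0 := by
    rw [← h1, Scheme.Modules.Hom.comp_app, ConcreteCategory.comp_apply, hy, map_zero]
  exact congrFun h2 ⟨hx⟩

end Skyscraper

/-! ### Sections vanishing on a closed subscheme. -/

section ClosedRestriction

/-- For a surjective ring homomorphism `σ : R → S` and an `R`-module `M`, the quotient of `M` by
`ker σ` as an `S`-module. -/
abbrev quotientKerModule {R S M : Type*} [CommRing R] [CommRing S] [AddCommGroup M] [Module R M]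
    (σ : R →+* S) (hσ : Function.Surjective σ) :
    Module S (M ⧸ (RingHom.ker σ • ⊤ : Submodule R M)) :=
  Module.compHom _ (RingHom.quotientKerEquivOfSurjective hσ).symm.toRingHom

lemma quotientKerModule_smul {R S M : Type*} [CommRing R] [CommRing S] [AddCommGroup M]
    [Module R M] (σ : R →+* S) (hσ : Function.Surjective σ) (r : R) (m : M) :
    let := quotientKerModule (M := M) σ hσ
    σ r • (Submodule.Quotient.mk m : M ⧸ (RingHom.ker σ • ⊤ : Submodule R M)) =
      Submodule.Quotient.mk (r • m) := by
  let := quotientKerModule (M := M) σ hσ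
  change (RingHom.quotientKerEquivOfSurjective hσ).symm (σ r) •
    (Submodule.Quotient.mk m : M ⧸ (RingHom.ker σ • ⊤ : Submodule R M)) = _
  have : (RingHom.quotientKerEquivOfSurjective hσ).symm (σ r) = Ideal.Quotient.mk _ r := by
    rw [RingEquiv.symm_apply_eq]
    rfl
  rw [this]
  rfl

variable {X : Scheme.{u}}

/-- The presheaf of modules underlying `F`, over the presheaf of commutative rings `𝒪_X`. -/
abbrev toPresheafOfCommRingModules (F : X.Modules) :
    PresheafOfModules.{u} (X.presheaf ⋙ forget₂ CommRingCat RingCat) := F.val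

instance stalkModule (F : X.Modules) (x : X) : Module (X.presheaf.stalk x) (F.presheaf.stalk x) :=
  inferInstanceAs (Module (X.presheaf.stalk x) (TopCat.Presheaf.stalk (C := Ab.{u})
    (toPresheafOfCommRingModules F).presheaf x))

lemma modules_germ_smul (F : X.Modules) (x : X) (U : X.Opens) (hx : x ∈ U) (a : Γ(X, U))
    (y : Γ(F, U)) : F.presheaf.germ U x hx (a • y) =
      X.presheaf.germ U x hx a • F.presheaf.germ U x hx y :=
  PresheafOfModules.germ_smul (toPresheafOfCommRingModules F) x U hx a y

lemma ker_stalkMap_subschemeι_le (J : X.IdealSheafData) (x : J.subscheme) :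
    RingHom.ker (J.subschemeι.stalkMap x).hom ≤ stalkIdeal J (J.subschemeι x) := by
  intro a ha
  obtain ⟨V, hV, g, rfl⟩ := X.presheaf.exists_germ_eq a
  rw [RingHom.mem_ker, Scheme.Hom.germ_stalkMap_apply] at ha
  rw [← map_zero (J.subscheme.presheaf.germ (J.subschemeι ⁻¹ᵁ V) x hV).hom] at ha
  obtain ⟨W, hxW, i, j, hW⟩ := J.subscheme.presheaf.germ_eq x hV hV _ _ ha
  rw [map_zero] at hW
  obtain ⟨W', hW', e⟩ := J.subschemeι.isEmbedding.isInducing.isOpen_iff.mp W.2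
  obtain ⟨U, hxU, hU⟩ := exists_affine_le (V ⊓ ⟨W', hW'⟩) (J.subschemeι x)
    ⟨hV, e.ge hxW⟩
  have hUV : U.1 ≤ V := hU.trans inf_le_left
  have hUW : J.subschemeι ⁻¹ᵁ U.1 ≤ W := fun z hz => e.le (hU hz).2
  have h0 : J.subschemeι.app U.1 (X.presheaf.map (homOfLE hUV).op g) = 0 := by
    have h1 := congrArg (J.subscheme.presheaf.map (homOfLE hUW).op) hW
    rw [map_zero, ring_res_res _ _ (homOfLE (hUW.trans i.le))] at h1
    rw [← h1, ← ConcreteCategory.comp_apply, J.subschemeι.naturality]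
    rfl
  have h1 : X.presheaf.map (homOfLE hUV).op g ∈ J.ideal U := by
    rw [← J.ker_subschemeι_app U]
    exact h0
  rw [stalkIdeal_eq_map J _ U hxU, ← X.presheaf.germ_res_apply (homOfLE hUV) _ hxU]
  exact Ideal.mem_map_of_mem _ h1

lemma exists_eq_smul_of_mem_span_singleton_smul_top {R M : Type*} [CommRing R] [AddCommGroup M]
    [Module R M] {r : R} {m : M} (h : m ∈ (Ideal.span {r} • ⊤ : Submodule R M)) :
    ∃ m', m = r • m' := by
  rw [Submodule.ideal_span_singleton_smul, Submodule.mem_smul_pointwise_iff_exists] at h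
  obtain ⟨m', -, rfl⟩ := h
  exact ⟨m', rfl⟩

/-- The skyscraper test is applied to the quotient of the stalk of `F` by the kernel of `𝒪_X → 𝒪_Z`
on stalks, a kernel contained in the stalk of `J`. -/
lemma germ_mem_of_unit_eq_zero (J : X.IdealSheafData) (F : X.Modules) (x : J.subscheme)
    (U : X.Opens) (hx : J.subschemeι x ∈ U) (y : Γ(F, U))
    (hy : ((Scheme.Modules.pullbackPushforwardAdjunction J.subschemeι).unit.app F).app U y = 0) :
    F.presheaf.germ U (J.subschemeι x) hx y ∈
      (stalkIdeal J (J.subschemeι x) • ⊤ : Submodule (X.presheaf.stalk (J.subschemeι x)) _) := by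
  have hσ : Function.Surjective (J.subschemeι.stalkMap x).hom :=
    J.subschemeι.stalkMap_surjective x
  let := quotientKerModule (M := F.presheaf.stalk (J.subschemeι x)) _ hσ
  refine Submodule.smul_mono_left (ker_stalkMap_subschemeι_le J x) ?_
  rw [← Submodule.Quotient.mk_eq_zero]
  exact germ_eq_zero_of_unit_eq_zero x _ J.subschemeι F
    (Submodule.mkQ (RingHom.ker (J.subschemeι.stalkMap x).hom • ⊤ :
      Submodule _ (F.presheaf.stalk (J.subschemeι x)))).toAddMonoidHom (fun U hx a y => by
        refine (congrArg _ (modules_germ_smul F _ U hx a y)).trans ?_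
        exact (quotientKerModule_smul _ hσ _ _).symm) U hx y hy

lemma exists_res_eq_smul_of_germ_mem (F : X.Modules) {x : X} {J : X.IdealSheafData}
    {U : X.affineOpens} (hx : x ∈ U.1) {g : Γ(X, U.1)} (hJ : J.ideal U = Ideal.span {g})
    (y : Γ(F, U.1)) (hy : F.presheaf.germ U.1 x hx y ∈
      (stalkIdeal J x • ⊤ : Submodule (X.presheaf.stalk x) (F.presheaf.stalk x))) :
    ∃ (V : X.affineOpens) (_ : x ∈ V.1) (i : V.1 ⟶ U.1) (z : Γ(F, V.1)),
      F.presheaf.map i.op y = X.presheaf.map i.op g • z := by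
  rw [stalkIdeal_eq_map J x U hx, hJ, Ideal.map_span, Set.image_singleton] at hy
  obtain ⟨m, hm⟩ := exists_eq_smul_of_mem_span_singleton_smul_top hy
  obtain ⟨V, hxV, z, rfl⟩ := F.presheaf.exists_germ_eq m
  obtain ⟨W, hxW, hW⟩ := exists_affine_le (U.1 ⊓ V) x ⟨hx, hxV⟩
  have h1 : W.1 ≤ U.1 := hW.trans inf_le_left
  have h2 : W.1 ≤ V := hW.trans inf_le_right
  have hm' : F.presheaf.germ U.1 x hx y =
      F.presheaf.germ W.1 x hxW (X.presheaf.map (homOfLE h1).op g •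
        F.presheaf.map (homOfLE h2).op z) := by
    rw [modules_germ_smul, X.presheaf.germ_res_apply, F.presheaf.germ_res_apply]
    exact hm
  obtain ⟨W', hxW', i, j, e⟩ := F.presheaf.germ_eq x hx hxW _ _ hm'
  obtain ⟨A, hxA, hA⟩ := exists_affine_le W' x hxW'
  refine ⟨A, hxA, homOfLE (hA.trans i.le), F.presheaf.map (homOfLE (hA.trans (j.le.trans h2))).op z,
    ?_⟩
  have e' := congrArg (F.presheaf.map (homOfLE hA).op) e
  rw [res_res F i _ (homOfLE (hA.trans i.le)), res_res F j _ (homOfLE (hA.trans j.le)),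
    Scheme.Modules.map_smul, res_res F _ _ (homOfLE (hA.trans (j.le.trans h2))),
    ring_res_res _ _ (homOfLE (hA.trans i.le))] at e'
  exact e'

end ClosedRestriction

/-! ### The sheaf `j_* j^* F` for torsion-free `F`. -/

section AwayFrom

variable {k : Type u} [Field k] {D : SurfaceData k} {F : D.X.Modules}

lemma image_preimage_complOpen {X : Scheme.{u}} (C : Closeds X) (U : X.Opens) :
    (complOpen C).ι ''ᵁ ((complOpen C).ι ⁻¹ᵁ U) = U ⊓ complOpen C := by
  rw [Scheme.Hom.image_preimage_eq_opensRange_inf, Scheme.Opens.opensRange_ι, inf_comm]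

lemma toAwayFrom_injective [F.IsQuasicoherent] (hF : IsTorsionFreeSheaf F) (U : D.X.Opens) :
    Function.Injective ((toAwayFrom D.C F).app U) := by
  rcases (U : Set D.X).eq_empty_or_nonempty with h | h
  · exact fun s t _ => modules_subsingleton F h s t
  · have hne := D.inter_compl_nonempty h
    rw [← image_preimage_complOpen] at hne
    exact res_injective hF (homOfLE ((image_preimage_complOpen D.C U).trans_le inf_le_left)) hne

lemma res_bijective_of_eq {X : Scheme.{u}} (F : X.Modules) {U V : X.Opens} (e : V = U)
    (i : V ⟶ U) : Function.Bijective (F.presheaf.map i.op) := by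
  subst e
  rw [show ⇑(F.presheaf.map i.op) = id from funext fun s => res_self F i s]
  exact Function.bijective_id

lemma toAwayFrom_bijective {X : Scheme.{u}} (C : Closeds X) (F : X.Modules) {U : X.Opens}
    (hU : U ≤ complOpen C) : Function.Bijective ((toAwayFrom C F).app U) := by
  have e := (image_preimage_complOpen C U).trans (inf_eq_left.mpr hU)
  have h1 : (toAwayFrom C F).app U = F.presheaf.map (eqToHom e).op := rfl
  rw [h1]
  exact res_bijective_of_eq F e _

lemma awayFrom_res_injective [F.IsQuasicoherent] (hF : IsTorsionFreeSheaf F) {U V : D.X.Opens}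
    (i : V ⟶ U) (hV : (V : Set D.X).Nonempty) :
    Function.Injective ((awayFrom D.C F).presheaf.map i.op) := by
  have hne := D.inter_compl_nonempty hV
  rw [← image_preimage_complOpen] at hne
  have h1 : (awayFrom D.C F).presheaf.map i.op = F.presheaf.map (homOfLE
      ((complOpen D.C).ι.image_mono ((complOpen D.C).ι.preimage_mono i.le))).op := rfl
  rw [h1]
  exact res_injective hF _ hne

lemma toAwayFrom_res {X : Scheme.{u}} (C : Closeds X) (F : X.Modules) {U V : X.Opens} (i : V ⟶ U)
    (y : Γ(F, U)) : (toAwayFrom C F).app V (F.presheaf.map i.op y) =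
      (awayFrom C F).presheaf.map i.op ((toAwayFrom C F).app U y) :=
  toAwayFrom_map C F i.le y

lemma isTorsionFreeSheaf_awayFrom [F.IsQuasicoherent] (hF : IsTorsionFreeSheaf F) :
    IsTorsionFreeSheaf (awayFrom D.C F) := by
  intro U a s h
  by_cases ha : a = 0
  · exact Or.inl ha
  right
  have hU : (U : Set D.X).Nonempty := by
    rw [Set.nonempty_iff_ne_empty]
    rintro hU
    have : U = ⊥ := by ext; simp [hU]
    subst this
    exact ha (Subsingleton.elim _ _)
  have hW := D.inter_compl_nonempty hU
  let i : U ⊓ complOpen D.C ⟶ U := homOfLE inf_le_left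
  refine awayFrom_res_injective hF i hW ?_
  rw [map_zero]
  obtain ⟨y, hy⟩ := (toAwayFrom_bijective D.C F (U := U ⊓ complOpen D.C) inf_le_right).2
    ((awayFrom D.C F).presheaf.map i.op s)
  have h1 : D.X.presheaf.map i.op a • y = 0 := by
    apply toAwayFrom_injective hF
    rw [Scheme.Modules.Hom.app_smul, hy, map_zero]
    refine (Scheme.Modules.map_smul (awayFrom D.C F) i a s).symm.trans ?_
    exact (congrArg _ h).trans (map_zero _)
  rcases hF _ _ _ h1 with h2 | h2
  · refine absurd (ring_res_injective i hW ?_) ha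
    rw [h2, map_zero]
  · rw [← hy, h2, map_zero]

/-- Over `D(h)`, which misses `C`, the section `s` comes from `F`. Quasi-coherence clears the
denominator over `U`, and injectivity of restriction carries the identity from `D(h)` back to `U`.
-/
lemma exists_toAwayFrom_eq_pow_smul [F.IsQuasicoherent] (hF : IsTorsionFreeSheaf F)
    {U : D.X.Opens} (hU : IsAffineOpen U) (h : Γ(D.X, U)) (hC : D.X.basicOpen h ≤ complOpen D.C)
    (s : Γ(awayFrom D.C F, U)) :
    ∃ (N : ℕ) (y : Γ(F, U)), (toAwayFrom D.C F).app U y = h ^ N • s := by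
  by_cases h0 : h = 0
  · exact ⟨1, 0, by rw [h0, map_zero, pow_one, zero_smul]⟩
  have hne : (D.X.basicOpen h : Set D.X).Nonempty := by
    rw [Set.nonempty_iff_ne_empty]
    intro he
    exact h0 ((basicOpen_eq_bot_iff h).mp (by ext; simp [he]))
  let i : D.X.basicOpen h ⟶ U := homOfLE (D.X.basicOpen_le h)
  obtain ⟨t, ht⟩ := (toAwayFrom_bijective D.C F hC).2 ((awayFrom D.C F).presheaf.map i.op s)
  obtain ⟨N, y, hy⟩ := exists_pow_smul_eq_res F hU h rfl (D.X.basicOpen_le h) t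
  refine ⟨N, y, awayFrom_res_injective hF i hne ?_⟩
  rw [← toAwayFrom_res]
  refine (congrArg _ hy).trans ?_
  rw [Scheme.Modules.Hom.app_smul, ht, ← map_pow]
  exact (Scheme.Modules.map_smul (awayFrom D.C F) i (h ^ N) s).symm

lemma toAwayFrom_res_eq_smul {X : Scheme.{u}} {C : Closeds X} {F : X.Modules} {U V : X.Opens}
    (i : V ⟶ U) {y : Γ(F, U)} {a : Γ(X, U)} {s : Γ(awayFrom C F, U)}
    (h : (toAwayFrom C F).app U y = a • s) :
    (toAwayFrom C F).app V (F.presheaf.map i.op y) =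
      X.presheaf.map i.op a • (awayFrom C F).presheaf.map i.op s := by
  refine (toAwayFrom_res C F i y).trans ?_
  refine (congrArg _ h).trans ?_
  exact Scheme.Modules.map_smul (awayFrom C F) i a s

end AwayFrom

/-! ### The expansion map `χ₁`: existence, uniqueness, linearity, injectivity. -/

section Expansion

variable {k : Type u} [Field k] {D : SurfaceData k} {F : D.X.Modules} (φ : StalkEmbedding D F)

lemma toLaurent_injective : Function.Injective (toLaurent (k := k)) :=
  HahnSeries.ofPowerSeries_injective

lemma toLaurent_X_pow_mul_single (n : ℕ) :
    toLaurent ((PowerSeries.X : k⟦X⟧⟦X⟧) ^ n) *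
      HahnSeries.single (-(n : ℤ)) 1 = 1 := by
  rw [toLaurent, HahnSeries.ofPowerSeries_X_pow, HahnSeries.single_mul_single]
  simp

lemma SurfaceData.isUnit_toLaurent_π_f : IsUnit (toLaurent (D.π₀ D.f)) := by
  obtain ⟨v, hv, h⟩ := D.exists_unit_π_f
  rw [h, map_mul]
  exact (IsUnit.of_mul_eq_one _ (toLaurent_X_pow_mul_single D.r)).mul (hv.map _)

variable {φ}

/-- Since `y = a s` and `z = b s`, cross-multiplication gives `b y = a z` in `j_* j^* F`, hence in
`F` on the overlap; then `φ` is applied to germs. -/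
lemma map_germ_comm [F.IsQuasicoherent] (hF : IsTorsionFreeSheaf F)
    (s : Γ(awayFrom D.C F, ⊤)) {U V : D.X.Opens} (hU : D.P ∈ U) (hV : D.P ∈ V)
    {a : Γ(D.X, U)} {b : Γ(D.X, V)} {y : Γ(F, U)} {z : Γ(F, V)}
    (hy : (toAwayFrom D.C F).app U y = a • (awayFrom D.C F).presheaf.map (homOfLE le_top).op s)
    (hz : (toAwayFrom D.C F).app V z = b • (awayFrom D.C F).presheaf.map (homOfLE le_top).op s) :
    D.π₀ (D.X.presheaf.germ V D.P hV b) * φ.toHom (F.presheaf.germ U D.P hU y) =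
      D.π₀ (D.X.presheaf.germ U D.P hU a) * φ.toHom (F.presheaf.germ V D.P hV z) := by
  let i : U ⊓ V ⟶ U := homOfLE inf_le_left
  let j : U ⊓ V ⟶ V := homOfLE inf_le_right
  have hP : D.P ∈ U ⊓ V := ⟨hU, hV⟩
  have hy' := toAwayFrom_res_eq_smul i hy
  have hz' := toAwayFrom_res_eq_smul j hz
  rw [res_res _ _ _ (homOfLE le_top)] at hy' hz'
  have key : D.X.presheaf.map j.op b • F.presheaf.map i.op y =
      D.X.presheaf.map i.op a • F.presheaf.map j.op z := by
    apply toAwayFrom_injective hF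
    rw [Scheme.Modules.Hom.app_smul, Scheme.Modules.Hom.app_smul, hy', hz', smul_comm]
  have := congrArg (fun t => φ.toHom (F.presheaf.germ (U ⊓ V) D.P hP t)) key
  simp only [φ.map_smul] at this
  rw [D.X.presheaf.germ_res_apply i D.P hP, D.X.presheaf.germ_res_apply j D.P hP] at this
  rw [← F.presheaf.germ_res_apply i D.P hP, ← F.presheaf.germ_res_apply j D.P hP]
  exact this

/-- Frees the expansion from the powers of `f` in its definition: any multiplier `b` bringing `s`
into `F` near `P` computes it. -/
lemma IsExpansion.map_germ_mul [F.IsQuasicoherent] (hF : IsTorsionFreeSheaf F)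
    {s : Γ(awayFrom D.C F, ⊤)} {w : LaurentSeries k⟦X⟧} (h : IsExpansion φ s w)
    {V : D.X.Opens} (hV : D.P ∈ V) {b : Γ(D.X, V)} {z : Γ(F, V)}
    (hz : (toAwayFrom D.C F).app V z = b • (awayFrom D.C F).presheaf.map (homOfLE le_top).op s) :
    toLaurent (D.π₀ (D.X.presheaf.germ V D.P hV b)) * w =
      toLaurent (φ.toHom (F.presheaf.germ V D.P hV z)) := by
  obtain ⟨U, hU, g, N, y, hg, hy, hw⟩ := h
  have h1 := congrArg toLaurent (map_germ_comm (φ := φ) hF s hU hV hy hz)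
  rw [map_mul, map_mul, ← hw, map_pow, hg, map_pow, map_pow] at h1
  refine (D.isUnit_toLaurent_π_f.pow N).mul_left_cancel ?_
  rw [← h1]
  ring

lemma exists_affine_germ_eq_f (D : SurfaceData k) :
    ∃ (U : D.X.affineOpens) (hP : D.P ∈ U.1) (g : Γ(D.X, U.1)),
      D.X.presheaf.germ U.1 D.P hP g = D.f := by
  obtain ⟨V, hV, g, hg⟩ := D.X.presheaf.exists_germ_eq D.f
  obtain ⟨U, hU, hUV⟩ := exists_affine_le V D.P hV
  refine ⟨U, hU, D.X.presheaf.map (homOfLE hUV).op g, ?_⟩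
  rw [← hg]
  exact D.X.presheaf.germ_res_apply (homOfLE hUV) D.P hU g

lemma exists_isExpansion [F.IsQuasicoherent] (hF : IsTorsionFreeSheaf F)
    (s : Γ(awayFrom D.C F, ⊤)) : ∃ w, IsExpansion φ s w := by
  obtain ⟨U, hP, g, hg⟩ := exists_affine_germ_eq_f D
  obtain ⟨N, y, hy⟩ := exists_toAwayFrom_eq_pow_smul hF U.2 g
    (D.basicOpen_le_compl_of_germ_eq hP hg)
    ((awayFrom D.C F).presheaf.map (homOfLE le_top).op s)
  obtain ⟨v, hv⟩ := (D.isUnit_toLaurent_π_f.pow N).exists_right_inv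
  refine ⟨v * toLaurent (φ.toHom (F.presheaf.germ U.1 D.P hP y)), U.1, hP, g, N, y, hg, hy, ?_⟩
  rw [← mul_assoc, hv, one_mul]

lemma IsExpansion.unique [F.IsQuasicoherent] (hF : IsTorsionFreeSheaf F)
    {s : Γ(awayFrom D.C F, ⊤)} {w w' : LaurentSeries k⟦X⟧} (h : IsExpansion φ s w)
    (h' : IsExpansion φ s w') : w = w' := by
  obtain ⟨U, hU, g, N, y, hg, hy, hw⟩ := h
  have := h'.map_germ_mul hF hU hy
  rw [map_pow, hg, map_pow, map_pow, ← hw] at this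
  exact ((D.isUnit_toLaurent_π_f.pow N).mul_left_cancel this).symm

lemma IsExpansion.add [F.IsQuasicoherent] (hF : IsTorsionFreeSheaf F)
    {s s' : Γ(awayFrom D.C F, ⊤)} {w w' : LaurentSeries k⟦X⟧} (h : IsExpansion φ s w)
    (h' : IsExpansion φ s' w') : IsExpansion φ (s + s') (w + w') := by
  obtain ⟨U, hP, g, hg⟩ := exists_affine_germ_eq_f D
  have hC := D.basicOpen_le_compl_of_germ_eq hP hg
  obtain ⟨N, y, hy⟩ := exists_toAwayFrom_eq_pow_smul hF U.2 g hC
    ((awayFrom D.C F).presheaf.map (homOfLE le_top).op s)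
  obtain ⟨N', y', hy'⟩ := exists_toAwayFrom_eq_pow_smul hF U.2 g hC
    ((awayFrom D.C F).presheaf.map (homOfLE le_top).op s')
  refine ⟨U.1, hP, g, N + N', g ^ N' • y + g ^ N • y', hg, ?_, ?_⟩
  · rw [map_add, Scheme.Modules.Hom.app_smul, Scheme.Modules.Hom.app_smul, hy, hy', smul_smul,
      smul_smul, ← pow_add, ← pow_add, add_comm N' N, ← smul_add]
    exact congrArg (g ^ (N + N') • ·) (map_add _ s s').symm
  · have e := h.map_germ_mul hF hP hy
    have e' := h'.map_germ_mul hF hP hy'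
    rw [map_pow, hg, map_pow, map_pow] at e e'
    rw [map_add, map_add, map_add, φ.map_smul, φ.map_smul, map_mul, map_mul, ← e, ← e', map_pow,
      hg, map_pow, map_pow, map_pow, hg, map_pow, map_pow]
    ring

lemma SurfaceData.π₀_germ_scalar (D : SurfaceData k) {U : D.X.Opens} (hU : D.P ∈ U) (c : k) :
    D.π₀ (D.X.presheaf.germ U D.P hU (D.X.presheaf.map (homOfLE le_top).op (scalar D.str ⊤ c))) =
      PowerSeries.C (PowerSeries.C c) := by
  rw [← D.π_scalar c, D.X.presheaf.germ_res_apply]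
  rfl

lemma IsExpansion.scalar_smul {s : Γ(awayFrom D.C F, ⊤)} {w : LaurentSeries k⟦X⟧}
    (h : IsExpansion φ s w) (c : k) :
    IsExpansion φ (scalar D.str ⊤ c • s) (HahnSeries.C (PowerSeries.C c) * w) := by
  obtain ⟨U, hP, g, N, y, hg, hy, hw⟩ := h
  refine ⟨U, hP, g, N, D.X.presheaf.map (homOfLE (le_top : U ≤ ⊤)).op (scalar D.str ⊤ c) • y,
    hg, ?_, ?_⟩
  · rw [Scheme.Modules.Hom.app_smul, hy, smul_comm]
    exact congrArg (g ^ N • ·) (Scheme.Modules.map_smul (awayFrom D.C F) _ _ s).symm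
  · rw [φ.map_smul, D.π₀_germ_scalar, map_mul, ← hw, toLaurent, HahnSeries.ofPowerSeries_C]
    ring

lemma IsExpansion.eq_zero [F.IsQuasicoherent] (hF : IsTorsionFreeSheaf F)
    {s : Γ(awayFrom D.C F, ⊤)} (h : IsExpansion φ s 0) : s = 0 := by
  obtain ⟨U, hP, g, N, y, hg, hy, hw⟩ := h
  rw [mul_zero] at hw
  have h1 : F.presheaf.germ U D.P hP y = F.presheaf.germ U D.P hP 0 := by
    apply φ.injective
    apply toLaurent_injective
    rw [← hw, map_zero, map_zero, map_zero]
  obtain ⟨W, hW, i, j, e⟩ := F.presheaf.germ_eq D.P hP hP _ _ h1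
  rw [map_zero] at e
  have h2 := toAwayFrom_res_eq_smul i hy
  rw [e, map_zero, map_pow, res_res _ _ _ (homOfLE le_top)] at h2
  have h3 := pow_smul_eq_zero_of_torsionFree (isTorsionFreeSheaf_awayFrom hF) _ (fun h0 => ?_) N _
    h2.symm
  · exact awayFrom_res_injective hF (homOfLE le_top) ⟨D.P, hW⟩ (h3.trans (map_zero _).symm)
  · apply D.f_ne_zero
    rw [← hg, ← D.X.presheaf.germ_res_apply i D.P hW, h0, map_zero]

end Expansion

/-! ### Local equations and pole conditions. -/

section LocalPoles

variable {X : Scheme.{u}}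

lemma ideal_eq_span_res {J : X.IdealSheafData} {U V : X.affineOpens} (h : V.1 ≤ U.1) {g : Γ(X, U.1)}
    (hg : J.ideal U = Ideal.span {g}) :
    J.ideal V = Ideal.span {X.presheaf.map (homOfLE h).op g} := by
  have h1 : V ≤ U := h
  rw [← J.map_ideal h1, hg, Ideal.map_span, Set.image_singleton]
  rfl

lemma ideal_pow_eq_span {J : X.IdealSheafData} {U : X.affineOpens} {g : Γ(X, U.1)}
    (hg : J.ideal U = Ideal.span {g}) (n : ℕ) : (J ^ n).ideal U = Ideal.span {g ^ n} := by
  rw [← Ideal.span_singleton_pow, ← hg]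
  rfl

lemma toAwayFrom_eq_smul_of_mem_span {C : Closeds X} {F : X.Modules} {U : X.Opens} {h a : Γ(X, U)}
    {s : Γ(awayFrom C F, U)} {y : Γ(F, U)} (hy : (toAwayFrom C F).app U y = h • s)
    (ha : a ∈ Ideal.span {h}) : ∃ z : Γ(F, U), (toAwayFrom C F).app U z = a • s := by
  obtain ⟨c, rfl⟩ := Ideal.mem_span_singleton'.mp ha
  exact ⟨c • y, by rw [Scheme.Modules.Hom.app_smul, hy, smul_smul]⟩

lemma pow_smul_cancel_of_torsionFree {G : X.Modules} (hG : IsTorsionFreeSheaf G) {U : X.Opens}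
    {g : Γ(X, U)} (hg : g ≠ 0) (n : ℕ) {s t : Γ(G, U)} (h : g ^ n • s = g ^ n • t) : s = t := by
  rw [← sub_eq_zero] at h ⊢
  exact pow_smul_eq_zero_of_torsionFree hG g hg n _ ((smul_sub _ _ _).trans h)

end LocalPoles

/-! ### Poles along `C'` against poles of the expansion. -/

variable {k : Type u} [Field k] {D : SurfaceData k} {F : D.X.Modules} {φ : StalkEmbedding D F}

lemma exists_eq_single_mul_of_hasPolesIn [F.IsQuasicoherent] (hF : IsTorsionFreeSheaf F) {n : ℕ}
    {s : Γ(awayFrom D.C F, ⊤)} (hs : HasPolesIn F D.C (D.I ^ n) ⊤ s) {w : LaurentSeries k⟦X⟧}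
    (hw : IsExpansion φ s w) : ∃ a : k⟦X⟧⟦X⟧,
      w = HahnSeries.single (-((n * D.d * D.r : ℕ) : ℤ)) 1 * toLaurent a := by
  obtain ⟨V, hP, hV, h⟩ := hs D.P trivial
  -- The elements `b` of `𝒪_P` making `π(b) w` a power series form an ideal, so it suffices to test
  -- germs of sections of `I ^ n`.
  have key : ∀ b ∈ stalkIdeal (D.I ^ n) D.P, ∃ z, toLaurent (D.π₀ b) * w = toLaurent z := by
    intro b hb
    rw [stalkIdeal_eq_map _ _ V hP] at hb
    refine Submodule.span_induction
      (p := fun b _ => ∃ z, toLaurent (D.π₀ b) * w = toLaurent z) ?_ ?_ ?_ ?_ hb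
    · rintro _ ⟨a, ha, rfl⟩
      obtain ⟨y, hy⟩ := h a ha
      exact ⟨_, hw.map_germ_mul hF hP hy⟩
    · exact ⟨0, by rw [map_zero, map_zero, zero_mul]⟩
    · rintro a b _ _ ⟨x, hx⟩ ⟨y, hy⟩
      exact ⟨x + y, by rw [map_add, map_add, map_add, add_mul, hx, hy]⟩
    · rintro a b _ ⟨x, hx⟩
      exact ⟨D.π₀ a * x, by rw [smul_eq_mul, map_mul, map_mul, map_mul, mul_assoc, hx]⟩
  obtain ⟨z, hz⟩ := key (D.f ^ (n * D.d)) (by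
    rw [stalkIdeal_pow, D.stalkIdeal_I, Ideal.span_singleton_pow, ← pow_mul, mul_comm n]
    exact Ideal.mem_span_singleton_self _)
  obtain ⟨v, hv, hπ⟩ := D.exists_unit_π_f
  obtain ⟨v', hv'⟩ := (hv.pow (n * D.d)).exists_right_inv
  refine ⟨v' * z, ?_⟩
  have h1 := toLaurent_X_pow_mul_single (k := k) (n * D.d * D.r)
  have h2 : toLaurent (v ^ (n * D.d)) * toLaurent v' = 1 := by rw [← map_mul, hv', map_one]
  rw [map_pow, hπ, mul_pow, ← pow_mul, map_mul, mul_comm D.r] at hz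
  rw [map_mul, ← hz]
  linear_combination (-w * toLaurent (v ^ (n * D.d)) * toLaurent v') * h1 - w * h2

lemma exists_poles_le_at_P [F.IsQuasicoherent] (hF : IsTorsionFreeSheaf F) {n : ℕ}
    {s : Γ(awayFrom D.C F, ⊤)} {w : LaurentSeries k⟦X⟧} (hw : IsExpansion φ s w)
    {y : F.presheaf.stalk D.P}
    (hy : toLaurent (D.π₀ D.f) ^ (n * D.d) * w = toLaurent (φ.toHom y)) :
    ∃ V : D.X.affineOpens, D.P ∈ V.1 ∧ ∃ hV : V.1 ≤ ⊤, ∀ a ∈ (D.I ^ n).ideal V,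
      ∃ y : Γ(F, V.1), (toAwayFrom D.C F).app V.1 y =
        a • (awayFrom D.C F).presheaf.map (homOfLE hV).op s := by
  obtain ⟨U, hU, g, N, x, hg, hx, hwx⟩ := hw
  obtain ⟨U', hU', y, rfl⟩ := F.presheaf.exists_germ_eq y
  obtain ⟨U₁, hU₁, h, -, hh⟩ := D.cartier D.P
  have hhn := ideal_pow_eq_span hh n
  -- As `I ^ n` has stalk `(f ^ (n * d))` at `P`, the local equation `h ^ n` is a multiple of `f ^
  -- (n * d)`; only this divisibility is used.
  obtain ⟨b, hb⟩ : ∃ b, b * D.f ^ (n * D.d) = D.X.presheaf.germ U₁.1 D.P hU₁ (h ^ n) := by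
    rw [← Ideal.mem_span_singleton', mul_comm n, pow_mul, ← Ideal.span_singleton_pow,
      ← D.stalkIdeal_I, ← stalkIdeal_pow, stalkIdeal_eq_map _ _ U₁ hU₁, hhn]
    exact Ideal.mem_map_of_mem _ (Ideal.mem_span_singleton_self _)
  obtain ⟨U₂, hU₂, b, rfl⟩ := D.X.presheaf.exists_germ_eq b
  obtain ⟨W, hPW, hW⟩ := exists_affine_le (U ⊓ U' ⊓ (U₁.1 ⊓ U₂)) D.P ⟨⟨hU, hU'⟩, hU₁, hU₂⟩
  let iU : W.1 ⟶ U := homOfLE (hW.trans (inf_le_left.trans inf_le_left))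
  let iU' : W.1 ⟶ U' := homOfLE (hW.trans (inf_le_left.trans inf_le_right))
  let iU₁ : W.1 ⟶ U₁.1 := homOfLE (hW.trans (inf_le_right.trans inf_le_left))
  let iU₂ : W.1 ⟶ U₂ := homOfLE (hW.trans (inf_le_right.trans inf_le_right))
  have hgW : D.X.presheaf.germ W.1 D.P hPW (D.X.presheaf.map iU.op g) = D.f :=
    (D.X.presheaf.germ_res_apply iU D.P hPW g).trans hg
  -- Two descriptions of `w`, by `f ^ N s = x` and by assumption 1, give `f ^ (n * d) x = f ^ N y`
  -- in the stalk. Injective restriction moves this to `W`, where cancelling `g ^ N` leaves `g ^ (n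
  -- * d) s = y`.
  have e1 : F.presheaf.germ W.1 D.P hPW
        (D.X.presheaf.map iU.op g ^ (n * D.d) • F.presheaf.map iU.op x) =
      F.presheaf.germ W.1 D.P hPW (D.X.presheaf.map iU.op g ^ N • F.presheaf.map iU'.op y) := by
    apply φ.injective
    apply toLaurent_injective
    rw [φ.map_smul, φ.map_smul, map_pow, map_pow, hgW, F.presheaf.germ_res_apply iU D.P hPW,
      F.presheaf.germ_res_apply iU' D.P hPW, map_mul, map_mul, ← hwx, ← hy, map_pow, map_pow,
      map_pow, map_pow, hgW]
    ring
  have e2 : D.X.presheaf.germ W.1 D.P hPW (D.X.presheaf.map iU₂.op b *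
        D.X.presheaf.map iU.op g ^ (n * D.d)) =
      D.X.presheaf.germ W.1 D.P hPW (D.X.presheaf.map iU₁.op h ^ n) := by
    rw [map_mul, map_pow, hgW, D.X.presheaf.germ_res_apply iU₂ D.P hPW, hb, map_pow, map_pow,
      D.X.presheaf.germ_res_apply iU₁ D.P hPW]
  obtain ⟨W', hPW', i, j, e1⟩ := F.presheaf.germ_eq D.P hPW hPW _ _ e1
  have e2 : D.X.presheaf.map iU₂.op b * D.X.presheaf.map iU.op g ^ (n * D.d) =
      D.X.presheaf.map iU₁.op h ^ n := germ_injective_of_isIntegral D.X D.P hPW e2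
  obtain rfl : i = j := Subsingleton.elim _ _
  have e1 := res_injective hF i ⟨D.P, hPW'⟩ e1
  have hx' := toAwayFrom_res_eq_smul iU hx
  rw [res_res _ _ _ (homOfLE le_top)] at hx'
  have hg0 : D.X.presheaf.map iU.op g ≠ 0 := fun h0 => D.f_ne_zero (by rw [← hgW, h0, map_zero])
  have e3 : (toAwayFrom D.C F).app W.1 (F.presheaf.map iU'.op y) =
      D.X.presheaf.map iU.op g ^ (n * D.d) •
        (awayFrom D.C F).presheaf.map (homOfLE le_top).op s := by
    refine pow_smul_cancel_of_torsionFree (isTorsionFreeSheaf_awayFrom hF) hg0 N ?_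
    rw [← Scheme.Modules.Hom.app_smul, ← e1, Scheme.Modules.Hom.app_smul, hx', map_pow, smul_comm]
  refine ⟨W, hPW, le_top, fun a ha => toAwayFrom_eq_smul_of_mem_span e3 ?_⟩
  rw [ideal_eq_span_res iU₁.le hhn, map_pow] at ha
  refine Ideal.span_singleton_le_span_singleton.mpr ?_ ha
  exact ⟨_, e2.symm.trans (mul_comm _ _)⟩

lemma unit_app_eq_zero_of_eq_smul {X : Scheme.{u}} (J : X.IdealSheafData) (F : X.Modules)
    {V : X.affineOpens} {a : Γ(X, V.1)} (ha : a ∈ J.ideal V) (z : Γ(F, V.1)) :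
    ((Scheme.Modules.pullbackPushforwardAdjunction J.subschemeι).unit.app F).app V.1
      (a • z) = 0 := by
  rw [Scheme.Modules.Hom.app_smul]
  rw [← J.ker_subschemeι_app V, RingHom.mem_ker] at ha
  have h : ∀ t : Γ((Scheme.Modules.pushforward J.subschemeι).obj
      ((Scheme.Modules.pullback J.subschemeι).obj F), V.1), a • t = 0 := fun t => by
    let t' : Γ((Scheme.Modules.pullback J.subschemeι).obj F, J.subschemeι ⁻¹ᵁ V.1) := t
    exact (congrArg (· • t') ha).trans (zero_smul _ t')
  exact h _

/-- A one-dimensional support cannot fit inside the proper closed subset of `C` where the pole bound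
fails. -/
lemma hasPolesIn_of_purity [F.IsQuasicoherent] (hF : IsTorsionFreeSheaf F)
    (hpure : ∀ m : ℕ, 0 < m → IsPureOfDimOne (restrictToMultiple F m)) {n : ℕ}
    {s : Γ(awayFrom D.C F, ⊤)}
    (hs : ∃ V : D.X.affineOpens, D.P ∈ V.1 ∧ ∃ hV : V.1 ≤ ⊤, ∀ a ∈ (D.I ^ n).ideal V,
      ∃ y : Γ(F, V.1), (toAwayFrom D.C F).app V.1 y =
        a • (awayFrom D.C F).presheaf.map (homOfLE hV).op s) :
    HasPolesIn F D.C (D.I ^ n) ⊤ s := by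
  let Z : Set D.X := {p | ¬ ∃ V : D.X.affineOpens, p ∈ V.1 ∧ ∃ hV : V.1 ≤ ⊤,
    ∀ a ∈ (D.I ^ n).ideal V, ∃ y : Γ(F, V.1), (toAwayFrom D.C F).app V.1 y =
      a • (awayFrom D.C F).presheaf.map (homOfLE hV).op s}
  have hZ : IsClosed Z := by
    rw [← isOpen_compl_iff, isOpen_iff_forall_mem_open]
    intro p hp
    obtain ⟨V, hpV, hV⟩ := not_not.mp hp
    exact ⟨V.1, fun q hq => not_not.mpr ⟨V, hq, hV⟩, V.1.2, hpV⟩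
  have hZC : Z ⊂ (D.C : Set D.X) := by
    refine ⟨fun p hp => ?_, fun h => h D.P_mem hs⟩
    by_contra hpC
    obtain ⟨V, hpV, hV⟩ := exists_affine_le (complOpen D.C) p hpC
    exact hp ⟨V, hpV, le_top, fun a _ => (toAwayFrom_bijective D.C F hV).2 _⟩
  intro p _
  by_contra hpZ
  change p ∈ Z at hpZ
  obtain ⟨U, hpU, g, hg, hI⟩ := D.cartier p
  have : Nonempty U.1 := ⟨⟨p, hpU⟩⟩
  have hg0 : g ≠ 0 := nonZeroDivisors.ne_zero hg
  have hgC := D.basicOpen_le_compl hI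
  obtain ⟨N, y, hy⟩ := exists_toAwayFrom_eq_pow_smul hF U.2 g hgC
    ((awayFrom D.C F).presheaf.map (homOfLE le_top).op s)
  obtain ⟨m, hm, y, hy⟩ : ∃ m, 0 < m ∧ ∃ y : Γ(F, U.1), (toAwayFrom D.C F).app U.1 y =
      (g ^ m * g ^ n) • (awayFrom D.C F).presheaf.map (homOfLE le_top).op s := by
    -- The exponent `N + 1` rather than `N` ensures `m > 0`, as purity requires.
    refine ⟨N + 1, Nat.succ_pos N, g ^ (n + 1) • y, ?_⟩
    rw [Scheme.Modules.Hom.app_smul, hy, smul_smul]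
    congr 1
    ring
  -- If `y = g ^ m z` near `q`, cancelling `g ^ m` yields `g ^ n s = z`, so the pole bound holds at
  -- `q`.
  have hgood : ∀ (q : D.X) (V : D.X.affineOpens) (i : V.1 ⟶ U.1) (_ : q ∈ V.1) (z : Γ(F, V.1)),
      F.presheaf.map i.op y = D.X.presheaf.map i.op (g ^ m) • z → q ∉ Z := by
    intro q V i hq z hz
    have hgV : D.X.presheaf.map i.op g ≠ 0 := fun h0 => hg0
      (ring_res_injective i ⟨q, hq⟩ (by rw [h0, map_zero]))
    have h1 := toAwayFrom_res_eq_smul i hy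
    rw [hz, Scheme.Modules.Hom.app_smul, map_mul, mul_smul, map_pow,
      res_res _ _ _ (homOfLE le_top)] at h1
    have h2 := pow_smul_cancel_of_torsionFree (isTorsionFreeSheaf_awayFrom hF) hgV m h1
    refine not_not.mpr ⟨V, hq, le_top, fun a ha => toAwayFrom_eq_smul_of_mem_span h2 ?_⟩
    rwa [ideal_eq_span_res i.le (ideal_pow_eq_span hI n)] at ha
  have hIm := ideal_pow_eq_span hI m
  let ι := (D.I ^ m).subschemeι
  -- A point of `C` lies on `mC'`, because `D(g)` misses `C`.
  obtain ⟨x, rfl⟩ : p ∈ Set.range ι := by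
    rw [Scheme.IdealSheafData.range_subschemeι, SetLike.mem_coe,
      Scheme.IdealSheafData.mem_support_iff_of_mem hpU, hIm, Scheme.mem_zeroLocus_iff]
    rintro _ ha hp
    obtain ⟨c, rfl⟩ := Ideal.mem_span_singleton'.mp ha
    rw [Scheme.basicOpen_mul] at hp
    exact hgC ((D.X.basicOpen_pow g hm).le hp.2) (hZC.1 hpZ)
  let σ : Γ(restrictToMultiple F m, ι ⁻¹ᵁ U.1) :=
    ((Scheme.Modules.pullbackPushforwardAdjunction ι).unit.app F).app U.1 y
  have hσ : σ ≠ 0 := by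
    intro h0
    obtain ⟨V, hV, i, z, hz⟩ := exists_res_eq_smul_of_germ_mem F hpU hIm y
      (germ_mem_of_unit_eq_zero _ F x U.1 hpU y h0)
    exact hgood _ V i hV z hz hpZ
  -- Off `Z` the section `g ^ n s` is some `z` in `F`, so `y = g ^ m z` dies in the restriction to
  -- `mC'`.
  have hιZ : ∀ q (hq : q ∈ ι ⁻¹ᵁ U.1),
      (restrictToMultiple F m).presheaf.germ (ι ⁻¹ᵁ U.1) q hq σ ≠ 0 → ι q ∈ Z := by
    intro q hq hne
    by_contra hqZ
    obtain ⟨V, hqV, hV, h⟩ := not_not.mp hqZ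
    obtain ⟨W, hqW, hW⟩ := exists_affine_le (U.1 ⊓ V.1) (ι q) ⟨hq, hqV⟩
    let i : W.1 ⟶ U.1 := homOfLE (hW.trans inf_le_left)
    obtain ⟨z, hz⟩ := hasPolesIn_shrink F D.C (D.I ^ n) (hW.trans inf_le_right) _ h
      (D.X.presheaf.map i.op (g ^ n)) (by
        rw [ideal_eq_span_res i.le (ideal_pow_eq_span hI n)]
        exact Ideal.mem_span_singleton_self _)
    rw [res_res _ _ _ (homOfLE le_top)] at hz
    have h1 := toAwayFrom_res_eq_smul i hy
    rw [res_res _ _ _ (homOfLE le_top), map_mul, mul_smul, ← hz,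
      ← Scheme.Modules.Hom.app_smul] at h1
    have h2 := toAwayFrom_injective hF _ h1
    have h3 := unit_app_eq_zero_of_eq_smul (D.I ^ m) F (V := W)
      (a := D.X.presheaf.map i.op (g ^ m)) (by
        rw [ideal_eq_span_res i.le hIm]
        exact Ideal.mem_span_singleton_self _) z
    rw [← h2] at h3
    have h4 : (restrictToMultiple F m).presheaf.map
        (homOfLE (ι.preimage_mono i.le) : ι ⁻¹ᵁ W.1 ⟶ ι ⁻¹ᵁ U.1).op σ = 0 :=
      (ConcreteCategory.congr_hom (((Scheme.Modules.pullbackPushforwardAdjunction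
        ι).unit.app F).mapPresheaf.naturality i.op) y).symm.trans h3
    apply hne
    rw [← (restrictToMultiple F m).presheaf.germ_res_apply
      (homOfLE (ι.preimage_mono i.le) : ι ⁻¹ᵁ W.1 ⟶ ι ⁻¹ᵁ U.1) q hqW, h4, map_zero]
  refine topologicalKrullDim_ne_one_of_subset D.irreducible_C D.dim_C hZ hZC (ι ∘ Subtype.val)
    (ι.isEmbedding.isInducing.comp Topology.IsInducing.subtypeVal) ?_ (hpure m hm _ σ hσ)
  rintro ⟨q, hq, hne⟩
  exact hιZ q hq hne

end RestrictedSchur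

end

theorem lemma2p1 {k : Type u} [Field k] [CharZero k] (D : SurfaceData k)
    (F : D.X.Modules) [F.IsQuasicoherent] (hF : IsTorsionFreeSheaf F) (φ : StalkEmbedding D F)
    (hφ : ∀ (n : ℕ), ∀ w ∈ filtrationW φ (n * D.d), ∃ y : F.presheaf.stalk D.P,
      toLaurent (D.π₀ D.f) ^ (n * D.d) * w = toLaurent (φ.toHom y))
    (hpure : ∀ m : ℕ, 0 < m → IsPureOfDimOne (restrictToMultiple F m)) :
    ∀ n : ℕ, ∃ e : Γ(twistBy F n, ⊤) →+ LaurentSeries k⟦X⟧,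
      (∀ (c : k) (σ : Γ(twistBy F n, ⊤)),
        e (scalar D.str ⊤ c • σ) = HahnSeries.C (PowerSeries.C c) * e σ) ∧
      (∀ σ : Γ(twistBy F n, ⊤), IsExpansion φ ((twistι F D.C D.I n).app ⊤ σ) (e σ)) ∧
      Function.Injective e ∧
      Set.range e = filtrationW φ (n * D.d) := by
  intro n
  -- Uniqueness of expansions makes this pointwise choice additive and `k`-linear.
  choose w hw using fun s => exists_isExpansion (φ := φ) hF s
  let e : Γ(twistBy F n, ⊤) →+ LaurentSeries k⟦X⟧ :=
    AddMonoidHom.mk' (fun σ => w ((twistι F D.C D.I n).app ⊤ σ)) fun σ τ =>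
      (hw _).unique hF (by rw [map_add]; exact (hw _).add hF (hw _))
  -- The pole condition is the membership proof carried by a section of the twist.
  have hpoles : ∀ σ : Γ(twistBy F n, ⊤),
      HasPolesIn F D.C (D.I ^ n) ⊤ ((twistι F D.C D.I n).app ⊤ σ) := fun σ => σ.2
  refine ⟨e, fun c σ => ?_, fun σ => hw _, ?_, ?_⟩
  · refine (hw _).unique hF ?_
    rw [Scheme.Modules.Hom.app_smul]
    exact (hw _).scalar_smul c
  · rw [injective_iff_map_eq_zero]
    intro σ hσ
    have h1 := hw ((twistι F D.C D.I n).app ⊤ σ)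
    rw [show w ((twistι F D.C D.I n).app ⊤ σ) = 0 from hσ] at h1
    exact Subtype.ext (h1.eq_zero hF)
  · refine Set.Subset.antisymm ?_ fun v hv => ?_
    · rintro _ ⟨σ, rfl⟩
      exact ⟨⟨_, hw _⟩, exists_eq_single_mul_of_hasPolesIn hF (hpoles σ) (hw _)⟩
    · obtain ⟨s, hs⟩ := hv.1
      obtain ⟨y, hy⟩ := hφ n v hv
      have h1 := hasPolesIn_of_purity hF hpure (exists_poles_le_at_P hF hs hy)
      exact ⟨⟨s, h1⟩, (hw _).unique hF hs⟩
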